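/- Let $\Omega\subseteq\mathbb R^2$ be an open set that is $x$-simple, that is, whose intersection with every line $t=t_0$ of the $(t,x)$-plane is empty or an open (possibly unbounded) interval of that line, and let $\mathrm{pr}_t\Omega$ be its projection to the $t$-axis. Let $p\in\mathbb N$, $A\in C^\infty(\Omega,\mathrm M_p(\mathbb R))$ and $F\in C^\infty(\Omega,\mathbb R^p)$. A fundamental matrix on $\Omega$ of the homogeneous system $v_x=Av$ is a matrix function $\Phi\colon\Omega\to\mathrm M_p(\mathbb R)$, continuous with continuous $x$-derivative, such that $\Phi_x=A\Phi$ and every classical solution $v$ of $v_x=Av$ on $\Omega$ (continuous with continuous $x$-derivative) has the form $v=\Phi\zeta$ for exactly one $\zeta\in C(\mathrm{pr}_t\Omega,\mathbb R^p)$. Then the system $v_x=Av+F$ has a solution $\psi\in C^\infty(\Omega,\mathbb R^p)$, and the system $v_x=Av$ has a smooth fundamental matrix on $\Omega$. Moreover, for every such $\psi$ and every smooth fundamental matrix $\Phi$, a vector distribution $v\in\mathcal D'(\Omega,\mathbb R^p)$ satisfies $v_x=Av+F$ in the sense of distributions if and only if \[ v=T_\psi+\Phi\cdot(\zeta\otimes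 T_{\mathbf 1_{\mathbb R}})\big|_\Omega \] for some $\zeta\in\mathcal D'(\mathrm{pr}_t\Omega,\mathbb R^p)$. Here $T_\psi$ and $T_{\mathbf 1_{\mathbb R}}$ are the regular distributions associated with $\psi$ and with the indicator function of $\mathbb R$, and the tensor product, a distribution on $\mathrm{pr}_t\Omega\times\mathbb R$, is taken componentwise. -/

import Mathlib

open scoped Distributions ContDiff LineDeriv
open TopologicalSpace

noncomputable section

namespace DistODE

section Mul

variable {E : Type*} [NormedAddCommGroup E] [NormedSpace ℝ E] {Ω : Opens E}

theorem contDiff_mul_test {a : E → ℝ} (ha : ContDiffOn ℝ ∞ a Ω) {f : E → ℝ}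
    (hf : ContDiff ℝ ∞ f) (hs : tsupport f ⊆ Ω) : ContDiff ℝ ∞ (fun z => a z * f z) := by
  rw [contDiff_iff_contDiffAt]
  intro z
  by_cases hz : z ∈ tsupport f
  · exact (ha.contDiffAt (Ω.isOpen.mem_nhds (hs hz))).mul hf.contDiffAt
  · have h0 : (fun z => a z * f z) =ᶠ[nhds z] fun _ => 0 := by
      filter_upwards [(isClosed_tsupport f).isOpen_compl.mem_nhds hz] with y hy
      rw [image_eq_zero_of_notMem_tsupport hy, mul_zero]
    exact contDiffAt_const.congr_of_eventuallyEq h0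

/-- Multiplication of smooth functions supported in a compact `K ⊆ Ω` by a smooth function
on `Ω`, as a continuous linear map. -/
def mulSupportedIn (a : E → ℝ) (ha : ContDiffOn ℝ ∞ a Ω) (K : Compacts E)
    (hK : (K : Set E) ⊆ Ω) : 𝓓_{K}(E, ℝ) →L[ℝ] 𝓓_{K}(E, ℝ) :=
  ContDiffMapSupportedIn.mkCLM ℝ (fun f z => a z * f z)
    (fun f g x => by simp [mul_add])
    (fun c f x => by simp [mul_left_comm])
    (fun f => contDiff_mul_test ha f.contDiff (f.tsupport_subset.trans hK))
    (fun f x hx => by simp [f.zero_on_compl hx])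
    (fun i _ => by
      have hb : ∀ j : ℕ, ∃ C : ℝ, 0 ≤ C ∧ ∀ x ∈ K, ‖iteratedFDerivWithin ℝ j a Ω x‖ ≤ C := by
        intro j
        have hc : ContinuousOn (fun x => ‖iteratedFDerivWithin ℝ j a Ω x‖) K :=
          ((ha.continuousOn_iteratedFDerivWithin (by exact_mod_cast le_top)
            Ω.isOpen.uniqueDiffOn).mono hK).norm
        obtain ⟨C, hC⟩ := K.isCompact.bddAbove_image hc
        exact ⟨max C 0, le_max_right _ _, fun x hx =>
          (hC (Set.mem_image_of_mem _ hx)).trans (le_max_left _ _)⟩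
      choose C hC0 hC using hb
      refine ⟨Finset.range (i + 1), ∑ j ∈ Finset.range (i + 1), (i.choose j : ℝ) * C j,
        Finset.sum_nonneg fun j _ => mul_nonneg (Nat.cast_nonneg _) (hC0 j), fun f x hx => ?_⟩
      have hx' := hK hx
      have hn : (i : ℕ∞ω) ≤ ∞ := by exact_mod_cast le_top
      have key := norm_iteratedFDerivWithin_mul_le ha (f.contDiff.contDiffOn (s := (Ω : Set E)))
        Ω.isOpen.uniqueDiffOn hx' hn
      rw [iteratedFDerivWithin_of_isOpen i Ω.isOpen hx'] at key
      refine key.trans ?_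
      rw [Finset.sum_mul]
      refine Finset.sum_le_sum fun j hj => ?_
      rw [iteratedFDerivWithin_of_isOpen (i - j) Ω.isOpen hx']
      refine mul_le_mul (mul_le_mul_of_nonneg_left (hC j x hx) (Nat.cast_nonneg _)) ?_
        (norm_nonneg _) (mul_nonneg (Nat.cast_nonneg _) (hC0 j))
      refine (ContDiffMapSupportedIn.norm_iteratedFDeriv_apply_le_seminorm_top ℝ).trans ?_
      exact Seminorm.le_finset_sup_apply (i := i - j)
        (p := fun j => ContDiffMapSupportedIn.seminorm ℝ E ℝ ⊤ K j)
        (by simp))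

/-- Multiplication of test functions on `Ω` by a smooth function on `Ω`. -/
def mulTest (a : E → ℝ) (ha : ContDiffOn ℝ ∞ a Ω) : 𝓓(Ω, ℝ) →L[ℝ] 𝓓(Ω, ℝ) :=
  TestFunction.limitCLM ℝ
    (fun f => ⟨fun z => a z * f z, contDiff_mul_test ha f.contDiff f.tsupport_subset,
      f.hasCompactSupport.mul_left,
      (closure_mono (Function.support_mul_subset_right _ _)).trans f.tsupport_subset⟩)
    (fun K hK => TestFunction.ofSupportedInCLM ℝ hK ∘L mulSupportedIn a ha K hK)
    (fun _ _ _ => rfl)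

@[simp]
theorem mulTest_apply (a : E → ℝ) (ha : ContDiffOn ℝ ∞ a Ω) (f : 𝓓(Ω, ℝ)) (z : E) :
    mulTest a ha f z = a z * f z := rfl

/-- The product `a · T` of a smooth function `a` on `Ω` and a distribution `T` on `Ω`:
`⟨a · T, f⟩ = ⟨T, a f⟩`. -/
def smulDistr (a : E → ℝ) (ha : ContDiffOn ℝ ∞ a Ω) (T : 𝓓'(Ω, ℝ)) : 𝓓'(Ω, ℝ) :=
  (mulTest a ha).precompCompactConvergenceCLM ℝ T

@[simp]
theorem smulDistr_apply (a : E → ℝ) (ha : ContDiffOn ℝ ∞ a Ω) (T : 𝓓'(Ω, ℝ)) (f : 𝓓(Ω, ℝ)) :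
    smulDistr a ha T f = T (mulTest a ha f) := rfl

/-- The restriction to `Ω₁ ⊆ Ω₂` of a distribution on `Ω₂`. -/
def restrictDistr {Ω₁ Ω₂ : Opens E} (_h : Ω₁ ≤ Ω₂) (T : 𝓓'(Ω₂, ℝ)) : 𝓓'(Ω₁, ℝ) :=
  (TestFunction.monoCLM ℝ : 𝓓(Ω₁, ℝ) →L[ℝ] 𝓓(Ω₂, ℝ)).precompCompactConvergenceCLM ℝ T

theorem restrictDistr_apply {Ω₁ Ω₂ : Opens E} (h : Ω₁ ≤ Ω₂) (T : 𝓓'(Ω₂, ℝ)) (f : 𝓓(Ω₁, ℝ)) :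
    restrictDistr h T f =
      T ⟨f, f.contDiff, f.hasCompactSupport, f.tsupport_subset.trans h⟩ := by
  change T (TestFunction.monoCLM ℝ f) = _
  congr 1
  ext z
  simp [h]

/-- The regular distribution `T_g` on `Ω` associated with a function `g` that is locally
integrable on `Ω`: `⟨T_g, f⟩ = ∫ f g`. -/
def regularDistr [MeasureTheory.MeasureSpace E] [OpensMeasurableSpace E] (g : E → ℝ) :
    𝓓'(Ω, ℝ) :=
  (TestFunction.integralAgainstBilinCLM (ContinuousLinearMap.mul ℝ ℝ)
    MeasureTheory.volume g : 𝓓(Ω, ℝ) →L[ℝ] ℝ)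

theorem regularDistr_apply [MeasureTheory.MeasureSpace E] [OpensMeasurableSpace E] {g : E → ℝ}
    (hg : MeasureTheory.LocallyIntegrableOn g Ω) (f : 𝓓(Ω, ℝ)) :
    (regularDistr g : 𝓓'(Ω, ℝ)) f = ∫ z, f z * g z :=
  TestFunction.integralAgainstBilinCLM_eq_integral hg

end Mul

section Tensor

variable {K : Compacts (ℝ × ℝ)} {X Y : Opens ℝ}

/-- The derivative along `m` of smooth functions supported in `K`. -/
def dirDeriv (m : ℝ × ℝ) : 𝓓_{K}(ℝ × ℝ, ℝ) →L[ℝ] 𝓓_{K}(ℝ × ℝ, ℝ) :=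
  ContDiffMapSupportedIn.postcompCLM (ContinuousLinearMap.apply ℝ ℝ m) ∘L
    ContDiffMapSupportedIn.fderivCLM ℝ ⊤ ⊤

theorem dirDeriv_apply (m : ℝ × ℝ) (f : 𝓓_{K}(ℝ × ℝ, ℝ)) (z : ℝ × ℝ) :
    dirDeriv m f z = fderiv ℝ f z m := by
  simp [dirDeriv]

theorem differentiable_supportedIn (f : 𝓓_{K}(ℝ × ℝ, ℝ)) : Differentiable ℝ f :=
  f.contDiff.differentiable (by simp)

theorem dirDeriv_comm (m m' : ℝ × ℝ) (f : 𝓓_{K}(ℝ × ℝ, ℝ)) :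
    dirDeriv m (dirDeriv m' f) = dirDeriv m' (dirDeriv m f) := by
  ext z
  have h2 : ∀ k : ℝ × ℝ, (dirDeriv k f : ℝ × ℝ → ℝ) = fun z => fderiv ℝ f z k :=
    fun k => funext fun z => dirDeriv_apply k f z
  have hd : DifferentiableAt ℝ (fderiv ℝ f) z :=
    ((f.contDiff.fderiv_right (m := ∞) (by simp)).differentiable (by simp)) z
  rw [dirDeriv_apply, dirDeriv_apply, h2, h2, fderiv_clm_apply hd (by fun_prop),
    fderiv_clm_apply hd (by fun_prop)]
  have hs : IsSymmSndFDerivAt ℝ f z :=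
    (f.contDiff.contDiffAt).isSymmSndFDerivAt (by
      rw [minSmoothness_of_isRCLikeNormedField]
      exact WithTop.coe_le_coe.2 le_top)
  simpa using hs m m'

theorem dirDeriv_iterate_comm (m m' : ℝ × ℝ) (j : ℕ) (f : 𝓓_{K}(ℝ × ℝ, ℝ)) :
    dirDeriv m ((dirDeriv m')^[j] f) = (dirDeriv m')^[j] (dirDeriv m f) :=
  ((Function.Commute.iterate_right (f := dirDeriv (K := K) m) (g := dirDeriv m')
    (fun g => dirDeriv_comm m m' g) j) f)

theorem seminorm_dirDeriv_le {m : ℝ × ℝ} (hm : ‖m‖ ≤ 1) (i : ℕ) (f : 𝓓_{K}(ℝ × ℝ, ℝ)) :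
    ContDiffMapSupportedIn.seminorm ℝ (ℝ × ℝ) ℝ ⊤ K i (dirDeriv m f) ≤
      ContDiffMapSupportedIn.seminorm ℝ (ℝ × ℝ) ℝ ⊤ K (i + 1) f := by
  refine (ContDiffMapSupportedIn.seminorm_postcompLM_le ℝ _ _).trans ?_
  have h1 : ‖ContinuousLinearMap.apply ℝ ℝ m‖ ≤ 1 :=
    ContinuousLinearMap.opNorm_le_bound _ zero_le_one fun L => by
      rw [ContinuousLinearMap.apply_apply, one_mul]
      exact (L.le_opNorm m).trans (mul_le_of_le_one_right (norm_nonneg _) hm)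
  refine (mul_le_of_le_one_left (apply_nonneg _ _) h1).trans ?_
  exact (ContDiffMapSupportedIn.seminorm_fderivLM_top ℝ f).le

theorem seminorm_dirDeriv_iterate_le {m : ℝ × ℝ} (hm : ‖m‖ ≤ 1) (j i : ℕ)
    (f : 𝓓_{K}(ℝ × ℝ, ℝ)) :
    ContDiffMapSupportedIn.seminorm ℝ (ℝ × ℝ) ℝ ⊤ K i ((dirDeriv m)^[j] f) ≤
      ContDiffMapSupportedIn.seminorm ℝ (ℝ × ℝ) ℝ ⊤ K (i + j) f := by
  induction j generalizing f with
  | zero => simp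
  | succ j ih =>
    rw [Function.iterate_succ_apply]
    exact (ih _).trans (seminorm_dirDeriv_le hm _ _)

/-- The slice `x ↦ f (t, x)`, for `f` supported in `K`. -/
def sliceK (f : 𝓓_{K}(ℝ × ℝ, ℝ)) (t : ℝ) : 𝓓_{K.map Prod.snd continuous_snd}(ℝ, ℝ) where
  toFun x := f (t, x)
  contDiff' := f.contDiff.comp (by fun_prop)
  zero_on_compl' x hx := f.zero_on_compl fun h => hx ⟨(t, x), h, rfl⟩

@[simp]
theorem sliceK_apply (f : 𝓓_{K}(ℝ × ℝ, ℝ)) (t x : ℝ) : sliceK f t x = f (t, x) := rfl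

theorem hasDerivAt_snd (f : 𝓓_{K}(ℝ × ℝ, ℝ)) (t x : ℝ) :
    HasDerivAt (fun x => f (t, x)) (dirDeriv (0, 1) f (t, x)) x := by
  rw [dirDeriv_apply]
  exact (differentiable_supportedIn f (t, x)).hasFDerivAt.comp_hasDerivAt x
    ((hasDerivAt_const x t).prodMk (hasDerivAt_id x))

theorem hasDerivAt_fst (f : 𝓓_{K}(ℝ × ℝ, ℝ)) (t x : ℝ) :
    HasDerivAt (fun t => f (t, x)) (dirDeriv (1, 0) f (t, x)) t := by
  rw [dirDeriv_apply]
  exact (differentiable_supportedIn f (t, x)).hasFDerivAt.comp_hasDerivAt t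
    ((hasDerivAt_id t).prodMk (hasDerivAt_const t x))

theorem iteratedDeriv_sliceK (j : ℕ) (f : 𝓓_{K}(ℝ × ℝ, ℝ)) (t : ℝ) :
    iteratedDeriv j (sliceK f t) = sliceK ((dirDeriv (0, 1))^[j] f) t := by
  induction j generalizing f with
  | zero => simp
  | succ j ih =>
    rw [iteratedDeriv_succ', Function.iterate_succ_apply, ← ih]
    congr 1
    ext x
    exact (hasDerivAt_snd f t x).deriv

/-- First-order Taylor estimate in the first variable. -/
theorem taylor_fst (g : 𝓓_{K}(ℝ × ℝ, ℝ)) (t s x : ℝ) :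
    |g (s, x) - g (t, x) - (s - t) * dirDeriv (1, 0) g (t, x)| ≤
      ContDiffMapSupportedIn.seminorm ℝ (ℝ × ℝ) ℝ ⊤ K 2 g * (s - t) ^ 2 := by
  set M := ContDiffMapSupportedIn.seminorm ℝ (ℝ × ℝ) ℝ ⊤ K 2 g
  have hM0 : 0 ≤ M := apply_nonneg _ _
  have hM : ∀ r, |dirDeriv (1, 0) (dirDeriv (1, 0) g) (r, x)| ≤ M := fun r =>
    (ContDiffMapSupportedIn.norm_apply_le_seminorm ℝ).trans
      (seminorm_dirDeriv_iterate_le (m := (1, 0)) (by simp) 2 0 g)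
  have h1 : ∀ r, |dirDeriv (1, 0) g (r, x) - dirDeriv (1, 0) g (t, x)| ≤ M * |r - t| := fun r =>
    convex_univ.norm_image_sub_le_of_norm_hasDerivWithin_le
      (f := fun r => dirDeriv (1, 0) g (r, x))
      (fun r _ => (hasDerivAt_fst (dirDeriv (1, 0) g) r x).hasDerivWithinAt)
      (fun r _ => hM r) (Set.mem_univ t) (Set.mem_univ r)
  have h2 := (convex_uIcc t s).norm_image_sub_le_of_norm_hasDerivWithin_le
    (f := fun r => g (r, x) - r * dirDeriv (1, 0) g (t, x)) (C := M * |s - t|)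
    (fun r _ => ((hasDerivAt_fst g r x).sub
      ((hasDerivAt_id r).mul_const (dirDeriv (1, 0) g (t, x)))).hasDerivWithinAt)
    (fun r hr => by
      rw [one_mul]
      refine (h1 r).trans (mul_le_mul_of_nonneg_left ?_ hM0)
      exact Set.abs_sub_left_of_mem_uIcc hr)
    Set.left_mem_uIcc Set.right_mem_uIcc
  have e : g (s, x) - g (t, x) - (s - t) * dirDeriv (1, 0) g (t, x) =
      g (s, x) - s * dirDeriv (1, 0) g (t, x) - (g (t, x) - t * dirDeriv (1, 0) g (t, x)) := by
    ring
  rw [e, ← sq_abs (s - t), pow_two, ← mul_assoc]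
  exact h2

/-- `t ↦ ⟨v, f (t, ·)⟩` for a continuous functional `v`. -/
def pairK (v : 𝓓_{K.map Prod.snd continuous_snd}(ℝ, ℝ) →L[ℝ] ℝ) (f : 𝓓_{K}(ℝ × ℝ, ℝ)) (t : ℝ) :
    ℝ := v (sliceK f t)

theorem exists_bound (v : 𝓓_{K.map Prod.snd continuous_snd}(ℝ, ℝ) →L[ℝ] ℝ) :
    ∃ (s : Finset ℕ) (C : ℝ), 0 ≤ C ∧ ∀ ψ, |v ψ| ≤ C * (s.sup fun j =>
      ContDiffMapSupportedIn.seminorm ℝ ℝ ℝ ⊤ (K.map Prod.snd continuous_snd) j) ψ := by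
  obtain ⟨s, C, -, h⟩ := Seminorm.bound_of_continuous
    (ContDiffMapSupportedIn.withSeminorms ℝ ℝ ℝ ⊤ (K.map Prod.snd continuous_snd))
    ((normSeminorm ℝ ℝ).comp v.toLinearMap) (continuous_norm.comp v.continuous)
  exact ⟨s, C, C.2, fun ψ => h ψ⟩

theorem hasDerivAt_pairK (v : 𝓓_{K.map Prod.snd continuous_snd}(ℝ, ℝ) →L[ℝ] ℝ)
    (f : 𝓓_{K}(ℝ × ℝ, ℝ)) (t : ℝ) :
    HasDerivAt (pairK v f) (pairK v (dirDeriv (1, 0) f) t) t := by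
  obtain ⟨s, C, hC, hv⟩ := exists_bound v
  set M := (s.sup fun j => ContDiffMapSupportedIn.seminorm ℝ (ℝ × ℝ) ℝ ⊤ K (2 + j)) f
  have hM : 0 ≤ M := apply_nonneg _ _
  have key : ∀ r, |pairK v f r - pairK v f t - (r - t) * pairK v (dirDeriv (1, 0) f) t| ≤
      C * M * (r - t) ^ 2 := by
    intro r
    have e : pairK v f r - pairK v f t - (r - t) * pairK v (dirDeriv (1, 0) f) t =
        v (sliceK f r - sliceK f t - (r - t) • sliceK (dirDeriv (1, 0) f) t) := by
      simp [pairK]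
    rw [e, mul_assoc]
    refine (hv _).trans (mul_le_mul_of_nonneg_left ?_ hC)
    refine Seminorm.finset_sup_apply_le (by positivity) fun j hj => ?_
    rw [ContDiffMapSupportedIn.seminorm_top_le_iff ℝ (by positivity)]
    intro x _
    rw [norm_iteratedFDeriv_eq_norm_iteratedDeriv]
    have cd : ∀ ψ : 𝓓_{K.map Prod.snd continuous_snd}(ℝ, ℝ), ContDiffAt ℝ (j : ℕ∞ω) ψ x :=
      fun ψ => (ψ.contDiff.of_le (by exact_mod_cast le_top)).contDiffAt
    have e2 : iteratedDeriv j
        ⇑(sliceK f r - sliceK f t - (r - t) • sliceK (dirDeriv (1, 0) f) t) x =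
        (dirDeriv (0, 1))^[j] f (r, x) - (dirDeriv (0, 1))^[j] f (t, x) -
          (r - t) * dirDeriv (1, 0) ((dirDeriv (0, 1))^[j] f) (t, x) := by
      rw [FunLike.coe_sub, FunLike.coe_sub, FunLike.coe_smul,
        iteratedDeriv_sub (f := ⇑(sliceK f r) - ⇑(sliceK f t))
          (g := (r - t) • ⇑(sliceK (dirDeriv (1, 0) f) t)) ((cd _).sub (cd _))
          ((cd (sliceK (dirDeriv (1, 0) f) t)).const_smul (r - t)),
        iteratedDeriv_sub (cd _) (cd _), iteratedDeriv_const_smul (cd _) (r - t),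
        iteratedDeriv_sliceK, iteratedDeriv_sliceK, iteratedDeriv_sliceK, dirDeriv_iterate_comm]
      simp
    rw [e2]
    refine (taylor_fst _ t r x).trans (mul_le_mul_of_nonneg_right ?_ (sq_nonneg _))
    refine (seminorm_dirDeriv_iterate_le (by simp) j 2 f).trans ?_
    exact Seminorm.le_finset_sup_apply
      (p := fun j => ContDiffMapSupportedIn.seminorm ℝ (ℝ × ℝ) ℝ ⊤ K (2 + j)) hj
  rw [hasDerivAt_iff_isLittleO]
  refine Asymptotics.IsBigO.trans_isLittleO (g := fun r => (r - t) ^ 2) ?_ ?_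
  · refine Asymptotics.IsBigO.of_bound (C * M) (Filter.Eventually.of_forall fun r => ?_)
    simpa using key r
  · have h0 : Filter.Tendsto (fun r => r - t) (nhds t) (nhds 0) := by
      simpa using (continuous_id.sub continuous_const).tendsto (x := t) (f := fun r => r - t)
    exact (Asymptotics.isLittleO_pow_id one_lt_two).comp_tendsto h0

theorem iteratedDeriv_pairK (v : 𝓓_{K.map Prod.snd continuous_snd}(ℝ, ℝ) →L[ℝ] ℝ)
    (k : ℕ) (f : 𝓓_{K}(ℝ × ℝ, ℝ)) :
    iteratedDeriv k (pairK v f) = pairK v ((dirDeriv (1, 0))^[k] f) := by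
  induction k generalizing f with
  | zero => simp
  | succ k ih =>
    rw [iteratedDeriv_succ', Function.iterate_succ_apply, ← ih]
    congr 1
    ext t
    exact (hasDerivAt_pairK v f t).deriv

theorem contDiff_pairK (v : 𝓓_{K.map Prod.snd continuous_snd}(ℝ, ℝ) →L[ℝ] ℝ)
    (f : 𝓓_{K}(ℝ × ℝ, ℝ)) : ContDiff ℝ ∞ (pairK v f) :=
  contDiff_of_differentiable_iteratedDeriv fun k _ => by
    rw [iteratedDeriv_pairK]
    exact fun t => (hasDerivAt_pairK v _ t).differentiableAt

theorem pairK_zero (v : 𝓓_{K.map Prod.snd continuous_snd}(ℝ, ℝ) →L[ℝ] ℝ)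
    (f : 𝓓_{K}(ℝ × ℝ, ℝ)) {t : ℝ} (ht : t ∉ K.map Prod.fst continuous_fst) :
    pairK v f t = 0 := by
  have h : sliceK f t = 0 := by
    ext x
    exact f.zero_on_compl fun h => ht ⟨(t, x), h, rfl⟩
  rw [pairK, h, map_zero]

/-- `f ↦ (t ↦ ⟨v, f (t, ·)⟩)` as a continuous linear map, for `f` supported in `K`. -/
def partialPairK (v : 𝓓_{K.map Prod.snd continuous_snd}(ℝ, ℝ) →L[ℝ] ℝ) :
    𝓓_{K}(ℝ × ℝ, ℝ) →L[ℝ] 𝓓_{K.map Prod.fst continuous_fst}(ℝ, ℝ) :=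
  letI Φ : 𝓓_{K}(ℝ × ℝ, ℝ) →ₗ[ℝ] 𝓓_{K.map Prod.fst continuous_fst}(ℝ, ℝ) :=
    { toFun f := ⟨pairK v f, contDiff_pairK v f, fun _ ht => pairK_zero v f ht⟩
      map_add' f g := ContDiffMapSupportedIn.ext fun t =>
        (congrArg v (by ext; rfl)).trans (map_add v (sliceK f t) (sliceK g t))
      map_smul' c f := ContDiffMapSupportedIn.ext fun t =>
        (congrArg v (by ext; rfl)).trans (map_smul v c (sliceK f t)) }
  { toLinearMap := Φ
    cont := show Continuous Φ by
      refine WithSeminorms.continuous_of_isBounded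
        (ContDiffMapSupportedIn.withSeminorms ℝ _ _ _ _)
        (ContDiffMapSupportedIn.withSeminorms ℝ _ _ _ _) _ (.of_real fun i => ?_)
      obtain ⟨s, C, hC, hv⟩ := exists_bound v
      refine ⟨s.image (· + i), C, fun f => ?_⟩
      refine (ContDiffMapSupportedIn.seminorm_top_le_iff ℝ
        (mul_nonneg hC (apply_nonneg _ _)) i (Φ f)).2 fun t _ => ?_
      change ‖iteratedFDeriv ℝ i (pairK v f) t‖ ≤ _
      rw [norm_iteratedFDeriv_eq_norm_iteratedDeriv, iteratedDeriv_pairK]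
      refine (hv _).trans (mul_le_mul_of_nonneg_left ?_ hC)
      refine Seminorm.finset_sup_apply_le (apply_nonneg _ _) fun j hj => ?_
      rw [ContDiffMapSupportedIn.seminorm_top_le_iff ℝ (apply_nonneg _ _)]
      intro x _
      rw [norm_iteratedFDeriv_eq_norm_iteratedDeriv, iteratedDeriv_sliceK]
      refine (ContDiffMapSupportedIn.norm_apply_le_seminorm ℝ (x := (t, x))
        (f := (dirDeriv (0, 1))^[j] ((dirDeriv (1, 0))^[i] f))).trans ?_
      refine (seminorm_dirDeriv_iterate_le (m := (0, 1)) (by simp) j 0 _).trans ?_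
      refine (seminorm_dirDeriv_iterate_le (m := (1, 0)) (by simp) i (0 + j) f).trans ?_
      exact Seminorm.le_finset_sup_apply (i := 0 + j + i)
        (p := fun j => ContDiffMapSupportedIn.seminorm ℝ (ℝ × ℝ) ℝ ⊤ K j)
        (Finset.mem_image.2 ⟨j, hj, by simp⟩) }

@[simp]
theorem partialPairK_apply (v : 𝓓_{K.map Prod.snd continuous_snd}(ℝ, ℝ) →L[ℝ] ℝ)
    (f : 𝓓_{K}(ℝ × ℝ, ℝ)) (t : ℝ) : partialPairK v f t = v (sliceK f t) := rfl

/-- The open set `X × Y`. -/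
def prodOpens (X Y : Opens ℝ) : Opens (ℝ × ℝ) :=
  ⟨(X : Set ℝ) ×ˢ (Y : Set ℝ), X.isOpen.prod Y.isOpen⟩

theorem snd_subset {K : Compacts (ℝ × ℝ)} (hK : (K : Set (ℝ × ℝ)) ⊆ prodOpens X Y) :
    (K.map Prod.snd continuous_snd : Set ℝ) ⊆ Y := by
  rintro _ ⟨z, hz, rfl⟩
  exact (hK hz).2

theorem fst_subset {K : Compacts (ℝ × ℝ)} (hK : (K : Set (ℝ × ℝ)) ⊆ prodOpens X Y) :
    (K.map Prod.fst continuous_fst : Set ℝ) ⊆ X := by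
  rintro _ ⟨z, hz, rfl⟩
  exact (hK hz).1

/-- The compact support of a test function. -/
def suppK (f : 𝓓(prodOpens X Y, ℝ)) : Compacts (ℝ × ℝ) := ⟨tsupport f, f.hasCompactSupport⟩

/-- A test function, seen as a smooth function supported in its own support. -/
def toK (f : 𝓓(prodOpens X Y, ℝ)) : 𝓓_{suppK f}(ℝ × ℝ, ℝ) :=
  .of_support_subset f.contDiff subset_closure

/-- The slice `f (t, ·)` of a test function `f` on `X × Y`, a test function on `Y`. -/
def slice (f : 𝓓(prodOpens X Y, ℝ)) (t : ℝ) : 𝓓(Y, ℝ) :=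
  TestFunction.ofSupportedIn (snd_subset (K := suppK f) f.tsupport_subset) (sliceK (toK f) t)

@[simp]
theorem slice_apply (f : 𝓓(prodOpens X Y, ℝ)) (t x : ℝ) : slice f t x = f (t, x) := rfl

/-- The continuous linear map `f ↦ (t ↦ ⟨v, f (t, ·)⟩)` from test functions on `X × Y` to
test functions on `X`, for a distribution `v` on `Y`. -/
def partialPair (v : 𝓓'(Y, ℝ)) : 𝓓(prodOpens X Y, ℝ) →L[ℝ] 𝓓(X, ℝ) :=
  TestFunction.limitCLM ℝ
    (fun f => (TestFunction.ofSupportedIn (fst_subset (K := suppK f) f.tsupport_subset)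
      (partialPairK ((v : 𝓓(Y, ℝ) →L[ℝ] ℝ) ∘L TestFunction.ofSupportedInCLM ℝ
        (snd_subset (K := suppK f) f.tsupport_subset)) (toK f))).copy
          (fun t => v (slice f t)) rfl)
    (fun _ hK => TestFunction.ofSupportedInCLM ℝ (fst_subset hK) ∘L
      partialPairK ((v : 𝓓(Y, ℝ) →L[ℝ] ℝ) ∘L TestFunction.ofSupportedInCLM ℝ (snd_subset hK)))
    (fun _ _ _ => TestFunction.ext fun _ => rfl)

@[simp]
theorem partialPair_apply (v : 𝓓'(Y, ℝ)) (f : 𝓓(prodOpens X Y, ℝ)) (t : ℝ) :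
    partialPair v f t = v (slice f t) := rfl

/-- The tensor product `u ⊗ v` of distributions: `⟨u ⊗ v, f⟩ = ⟨u(t), ⟨v(x), f (t, x)⟩⟩`. -/
def tensorDistr (u : 𝓓'(X, ℝ)) (v : 𝓓'(Y, ℝ)) : 𝓓'(prodOpens X Y, ℝ) :=
  (partialPair v).precompCompactConvergenceCLM ℝ u

@[simp]
theorem tensorDistr_apply (u : 𝓓'(X, ℝ)) (v : 𝓓'(Y, ℝ)) (f : 𝓓(prodOpens X Y, ℝ)) :
    tensorDistr u v f = u (partialPair v f) := rfl

end Tensor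

section System

/-- A subset of the `(t, x)`-plane is `x`-simple if its intersection with every line `t = const`
is an open (possibly unbounded) interval of this line or empty. -/
def IsXSimple (U : Set (ℝ × ℝ)) : Prop :=
  ∀ t : ℝ, ∃ a b : EReal, {x : ℝ | (t, x) ∈ U} = {x : ℝ | a < (x : EReal) ∧ (x : EReal) < b}

/-- The projection of an open set to the `t`-axis. -/
def prT (Ω : Opens (ℝ × ℝ)) : Opens ℝ :=
  ⟨Prod.fst '' (Ω : Set (ℝ × ℝ)), isOpenMap_fst _ Ω.isOpen⟩

theorem mem_prT {Ω : Opens (ℝ × ℝ)} {t x : ℝ} (h : (t, x) ∈ Ω) : t ∈ prT Ω :=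
  ⟨(t, x), h, rfl⟩

theorem le_prod_prT (Ω : Opens (ℝ × ℝ)) : Ω ≤ prodOpens (prT Ω) ⊤ :=
  fun _ hz => ⟨mem_prT hz, trivial⟩

/-- The class `C¹_x(Ω)`: continuous functions on `Ω` with a continuous derivative in `x`. -/
def IsC1x {V : Type*} [NormedAddCommGroup V] [NormedSpace ℝ V] (Ω : Opens (ℝ × ℝ))
    (g : ℝ × ℝ → V) : Prop :=
  ContinuousOn g Ω ∧ ∃ g' : ℝ × ℝ → V, ContinuousOn g' Ω ∧
    ∀ t x : ℝ, (t, x) ∈ Ω → HasDerivAt (fun y => g (t, y)) (g' (t, x)) x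

variable {p : ℕ}

/-- Classical solutions of `v_x = A v + F` on `Ω`. -/
def IsSolution (Ω : Opens (ℝ × ℝ)) (A : ℝ × ℝ → Matrix (Fin p) (Fin p) ℝ)
    (F : ℝ × ℝ → Fin p → ℝ) (v : ℝ × ℝ → Fin p → ℝ) : Prop :=
  IsC1x Ω v ∧ ∀ t x : ℝ, (t, x) ∈ Ω →
    HasDerivAt (fun y => v (t, y)) ((A (t, x)).mulVec (v (t, x)) + F (t, x)) x

/-- `Φ` is a fundamental matrix on `Ω` of the homogeneous system `v_x = A v`: it is a `C¹_x`
solution of `Φ_x = A Φ`, and every classical solution `v` of `v_x = A v` on `Ω` is `Φ ζ` for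
exactly one continuous vector function `ζ` on `pr_t Ω`. -/
structure IsFundamentalMatrix (Ω : Opens (ℝ × ℝ)) (A : ℝ × ℝ → Matrix (Fin p) (Fin p) ℝ)
    (Φ : ℝ × ℝ → Matrix (Fin p) (Fin p) ℝ) : Prop where
  isC1x : ∀ i j, IsC1x Ω (fun z => Φ z i j)
  hasDerivAt : ∀ t x : ℝ, (t, x) ∈ Ω → ∀ i j,
    HasDerivAt (fun y => Φ (t, y) i j) ((A (t, x) * Φ (t, x)) i j) x
  existsUnique : ∀ v : ℝ × ℝ → Fin p → ℝ, IsSolution Ω A 0 v →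
    ∃! ζ : C(prT Ω, Fin p → ℝ), ∀ (t x : ℝ) (h : (t, x) ∈ Ω),
      v (t, x) = (Φ (t, x)).mulVec (ζ ⟨t, mem_prT h⟩)

/-- The matrix `M` has smooth entries on `Ω`. -/
def SmoothMatrixOn (Ω : Opens (ℝ × ℝ)) (M : ℝ × ℝ → Matrix (Fin p) (Fin p) ℝ) : Prop :=
  ∀ i j, ContDiffOn ℝ ∞ (fun z => M z i j) Ω

/-- The regular vector distribution associated with a vector function. -/
def regularVecDistr (Ω : Opens (ℝ × ℝ)) (g : ℝ × ℝ → Fin p → ℝ) : Fin p → 𝓓'(Ω, ℝ) :=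
  fun i => regularDistr (fun z => g z i)

/-- The product `M · v` of a smooth matrix function and a vector distribution. -/
def mulVecDistr {Ω : Opens (ℝ × ℝ)} (M : ℝ × ℝ → Matrix (Fin p) (Fin p) ℝ)
    (hM : SmoothMatrixOn Ω M) (v : Fin p → 𝓓'(Ω, ℝ)) : Fin p → 𝓓'(Ω, ℝ) :=
  fun i => ∑ j, smulDistr (fun z => M z i j) (hM i j) (v j)

/-- The vector distribution `v` on `Ω` solves `v_x = A v + F` in the sense of distributions. -/
def IsDistrSolution {Ω : Opens (ℝ × ℝ)} (A : ℝ × ℝ → Matrix (Fin p) (Fin p) ℝ)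
    (hA : SmoothMatrixOn Ω A) (F : ℝ × ℝ → Fin p → ℝ) (v : Fin p → 𝓓'(Ω, ℝ)) : Prop :=
  ∀ i, ∂_{((0, 1) : ℝ × ℝ)} (v i) = (mulVecDistr A hA v + regularVecDistr Ω F) i

/-- The vector distribution `(ζ ⊗ T_1)|_Ω`, where `T_1` is the regular distribution on `ℝ`
associated with the indicator function of `ℝ`. -/
def tensorOne (Ω : Opens (ℝ × ℝ)) (ζ : Fin p → 𝓓'(prT Ω, ℝ)) : Fin p → 𝓓'(Ω, ℝ) :=
  fun i => restrictDistr (le_prod_prT Ω)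
    (tensorDistr (ζ i) (regularDistr (Set.univ.indicator fun _ : ℝ => 1) : 𝓓'(⊤, ℝ)))

end System

end DistODE

end

/-! Everything rests on a smooth invertible matrix solution of `Φ_x = A Φ`. If `N = Φ⁻¹`, then `N_x
= -N A`. For a distribution `v`, put `w = v - T_ψ` and `u = N w`: by the product rule, `v` solves
the inhomogeneous system exactly when `u_x = 0`. It remains to know which distributions have
vanishing `x`-derivative, and to construct the flows.

On an `x`-simple set, `u_x = 0` forces `u = ζ ⊗ 1`. Choose `χ` with integral one on every fibre
(`exists_isFibreBump`). For a test function `f` with fibre integrals `φ(t)`, the difference `f - φ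
χ` has vanishing fibre integrals, so it is the `x`-derivative of a test function
(`exists_lineDeriv_eq`). This uses that fibres are intervals: otherwise the primitive need not be
supported in `Ω`. Hence `u(f) = u(φ χ)`, and `ζ(φ) = u(φ χ)` works (`exists_eq_tensorOne`).

For the flow, a partition of unity gives a smooth curve `x = c(t)` in `Ω`. Rescaling the segment
from `(t, c t)` to `(t, x)` to the unit interval turns the initial value problem `Φ = 1` on the
curve into `g = 1 + V (B g)` in the Banach algebra `C(I, M_p)`, where `V` is integration from `0`.
The operator `1 - V B` is always invertible, since powers of `V B` decay factorially. The
coefficient `B` depends smoothly on `(t, x)`, and inversion is smooth, so the flow is jointly smooth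
(`contDiffOn_transport`). The flow of `-Aᵀ`, transposed, is the inverse; variation of constants
gives `ψ`.

An arbitrary smooth fundamental matrix is invertible because the columns of the constructed flow are
classical solutions and hence factor through it (`IsFundamentalMatrix.exists_inverse`). -/

noncomputable section

namespace DistODE

open scoped Manifold unitInterval
open Filter Topology

/-! ### Smooth dependence of curried maps with values in `C(I, F)` -/

section Curry

variable {E F : Type} [NormedAddCommGroup E] [NormedSpace ℝ E]
  [NormedAddCommGroup F] [NormedSpace ℝ F]

/-- The parameters `z` whose whole fibre over the unit interval lies in `W`. -/
def fullFibre (W : Set (E × ℝ)) : Set E := {z | ∀ s : I, (z, (s : ℝ)) ∈ W}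

-- Tube lemma: compactness of the unit interval makes local conditions along a fibre uniform.
omit [NormedSpace ℝ E] in
theorem eventually_forall_unitInterval {P : E × ℝ → Prop} {z : E}
    (h : ∀ s : I, ∀ᶠ q in 𝓝 (z, (s : ℝ)), P q) : ∀ᶠ y in 𝓝 z, ∀ s : I, P (y, (s : ℝ)) := by
  have := (isCompact_univ (X := I)).eventually_forall_of_forall_eventually (x₀ := z)
    (P := fun y s => P (y, (s : ℝ))) fun s _ =>
      (show Tendsto (fun q : E × I => (q.1, (q.2 : ℝ))) (𝓝 (z, s)) (𝓝 (z, (s : ℝ))) from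
        (continuous_fst.prodMk (continuous_subtype_val.comp continuous_snd)).tendsto _).eventually
        (h s)
  filter_upwards [this] with y hy s using hy s (Set.mem_univ s)

omit [NormedSpace ℝ E] in
theorem isOpen_fullFibre {W : Set (E × ℝ)} (hW : IsOpen W) : IsOpen (fullFibre W) :=
  isOpen_iff_mem_nhds.2 fun _ hz =>
    eventually_forall_unitInterval fun s => hW.mem_nhds (hz s)

/-- The curried map `z ↦ f (z, ·)`, restricted to the unit interval. -/
def curryI (f : E × ℝ → F) (z : E) : C(I, F) := ContinuousMap.mkD (fun s : I => f (z, s)) 0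

omit [NormedSpace ℝ E] [NormedSpace ℝ F] in
theorem curryI_apply {f : E × ℝ → F} {W : Set (E × ℝ)} (hf : ContinuousOn f W) {z : E}
    (hz : z ∈ fullFibre W) (s : I) : curryI f z s = f (z, s) :=
  ContinuousMap.mkD_apply_of_continuous
    (hf.comp_continuous (continuous_const.prodMk continuous_subtype_val) hz)

/-- A continuous family of linear maps, as a linear map into continuous functions. -/
def familyLM : C(I, E →L[ℝ] F) →ₗ[ℝ] E →ₗ[ℝ] C(I, F) where
  toFun g :=
    { toFun := fun e => ⟨fun s => g s e, by fun_prop⟩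
      map_add' := fun _ _ => by ext; simp
      map_smul' := fun _ _ => by ext; simp }
  map_add' _ _ := by ext; simp
  map_smul' _ _ := by ext; simp

theorem norm_familyLM_le (g : C(I, E →L[ℝ] F)) (e : E) : ‖familyLM g e‖ ≤ 1 * ‖g‖ * ‖e‖ := by
  rw [one_mul]
  exact (ContinuousMap.norm_le (familyLM g e) (by positivity)).2 fun s =>
    ((g s).le_opNorm e).trans
      (mul_le_mul_of_nonneg_right (g.norm_coe_le_norm s) (norm_nonneg e))

/-- A continuous family of linear maps, as a continuous linear map into continuous functions. -/
def familyCLM : C(I, E →L[ℝ] F) →L[ℝ] E →L[ℝ] C(I, F) :=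
  LinearMap.mkContinuous₂ (E := C(I, E →L[ℝ] F)) (F := E) (G := C(I, F))
    (𝕜 := ℝ) (𝕜₂ := ℝ) (𝕜₃ := ℝ)
    (σ₁₃ := RingHom.id ℝ) (σ₂₃ := RingHom.id ℝ) familyLM 1 norm_familyLM_le

@[simp]
theorem familyCLM_apply (g : C(I, E →L[ℝ] F)) (e : E) (s : I) : familyCLM g e s = g s e := rfl

/-- The supremum norm asks for an error bound uniform in `s`. The tube lemma gives a ball on which
`f'` varies by at most `ε` for all `s` at once, and the mean value inequality on that ball does the
rest. -/
theorem hasFDerivAt_curryI {W : Set (E × ℝ)} (hW : IsOpen W) {f : E × ℝ → F}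
    {f' : E × ℝ → E →L[ℝ] F} (hf : ContinuousOn f W) (hf' : ContinuousOn f' W)
    (hd : ∀ q ∈ W, HasFDerivAt (fun z => f (z, q.2)) (f' q) q.1) {z : E}
    (hz : z ∈ fullFibre W) :
    HasFDerivAt (curryI f) (familyCLM (curryI f' z)) z := by
  rw [hasFDerivAt_iff_isLittleO, Asymptotics.isLittleO_iff]
  intro ε hε
  have h1 : ∀ᶠ y in 𝓝 z, ∀ s : I, ‖f' (y, s) - f' (z, s)‖ ≤ ε := by
    refine eventually_forall_unitInterval
      (P := fun q : E × ℝ => ‖f' q - f' (z, q.2)‖ ≤ ε) fun s => ?_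
    have hc : ContinuousAt f' (z, (s : ℝ)) := hf'.continuousAt (hW.mem_nhds (hz s))
    have hc2 : Tendsto (fun q : E × ℝ => f' (z, q.2)) (𝓝 (z, (s : ℝ))) (𝓝 (f' (z, (s : ℝ)))) :=
      hc.tendsto.comp ((continuous_const.prodMk continuous_snd).tendsto (z, (s : ℝ)))
    have hc3 := (hc.tendsto.sub hc2).norm
    rw [sub_self, norm_zero] at hc3
    exact (hc3.eventually (gt_mem_nhds hε)).mono fun _ h => h.le
  obtain ⟨δ, hδ, hb⟩ := Metric.eventually_nhds_iff_ball.1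
    (h1.and ((isOpen_fullFibre hW).mem_nhds hz))
  filter_upwards [Metric.ball_mem_nhds z hδ] with y hy
  refine (ContinuousMap.norm_le _ (by positivity)).2 fun s => ?_
  have := (convex_ball z δ).norm_image_sub_le_of_norm_hasFDerivWithin_le'
    (f := fun w => f (w, (s : ℝ))) (f' := fun w => f' (w, (s : ℝ))) (φ := f' (z, (s : ℝ)))
    (C := ε) (fun w hw => (hd (w, s) ((hb w hw).2 s)).hasFDerivWithinAt)
    (fun w hw => (hb w hw).1 s) (Metric.mem_ball_self hδ) hy
  simpa [curryI_apply hf hz, curryI_apply hf' hz, curryI_apply hf (hb y hy).2] using this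

omit [NormedSpace ℝ E] [NormedSpace ℝ F] in
theorem continuousOn_curryI {W : Set (E × ℝ)} (hW : IsOpen W) {f : E × ℝ → F}
    (hf : ContinuousOn f W) : ContinuousOn (curryI f) (fullFibre W) := by
  intro z hz
  refine ContinuousAt.continuousWithinAt ?_
  rw [Metric.continuousAt_iff']
  intro ε hε
  have h1 : ∀ᶠ y in 𝓝 z, ∀ s : I, ‖f (y, s) - f (z, s)‖ < ε / 2 := by
    refine eventually_forall_unitInterval
      (P := fun q : E × ℝ => ‖f q - f (z, q.2)‖ < ε / 2) fun s => ?_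
    have hc : ContinuousAt f (z, (s : ℝ)) := hf.continuousAt (hW.mem_nhds (hz s))
    have hc2 : Tendsto (fun q : E × ℝ => f (z, q.2)) (𝓝 (z, (s : ℝ))) (𝓝 (f (z, (s : ℝ)))) :=
      hc.tendsto.comp ((continuous_const.prodMk continuous_snd).tendsto (z, (s : ℝ)))
    have hc3 := (hc.tendsto.sub hc2).norm
    rw [sub_self, norm_zero] at hc3
    exact hc3.eventually (gt_mem_nhds (half_pos hε))
  filter_upwards [h1, (isOpen_fullFibre hW).mem_nhds hz] with y hy hyW
  rw [dist_eq_norm]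
  refine lt_of_le_of_lt ((ContinuousMap.norm_le _ (half_pos hε).le).2 fun s => ?_)
    (half_lt_self hε)
  simpa [curryI_apply hf hz, curryI_apply hf hyW] using (hy s).le

/-- The derivative of a curried map is, up to the continuous linear map `familyCLM`, the curried
partial derivative, so induction applies. The target space varies in the induction because the
derivative takes values in `E →L[ℝ] F`. -/
theorem contDiffOn_curryI_nat {W : Set (E × ℝ)} (hW : IsOpen W) (n : ℕ) :
    ∀ {F : Type} [NormedAddCommGroup F] [NormedSpace ℝ F] {f : E × ℝ → F},
      ContDiffOn ℝ n f W → ContDiffOn ℝ n (curryI f) (fullFibre W) := by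
  induction n with
  | zero =>
    intro F _ _ f hf
    exact contDiffOn_zero.2 (continuousOn_curryI hW hf.continuousOn)
  | succ n ih =>
    intro F _ _ f hf
    have hU := isOpen_fullFibre hW
    set f' : E × ℝ → E →L[ℝ] F := fun q => (fderiv ℝ f q).comp (ContinuousLinearMap.inl ℝ E ℝ)
    have hf' : ContDiffOn ℝ n f' W :=
      ((ContinuousLinearMap.compL ℝ E (E × ℝ) F).flip
        (ContinuousLinearMap.inl ℝ E ℝ)).contDiff.comp_contDiffOn
        (hf.fderiv_of_isOpen hW (by norm_cast))
    have hd : ∀ z ∈ fullFibre W, HasFDerivAt (curryI f) (familyCLM (curryI f' z)) z := by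
      intro z hz
      refine hasFDerivAt_curryI hW hf.continuousOn hf'.continuousOn (fun q hq => ?_) hz
      have h1 : HasFDerivAt f (fderiv ℝ f q) q :=
        ((hf.differentiableOn (by simp)).differentiableAt (hW.mem_nhds hq)).hasFDerivAt
      exact h1.comp q.1 (hasFDerivAt_prodMk_left q.1 q.2)
    push_cast
    rw [contDiffOn_succ_iff_fderiv_of_isOpen hU]
    refine ⟨fun z hz => (hd z hz).differentiableAt.differentiableWithinAt, by simp, ?_⟩
    have hL : ContDiff ℝ n fun g : C(I, E →L[ℝ] F) => familyCLM g := by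
      fun_prop
    have h : ContDiffOn ℝ n (fun z => familyCLM (curryI f' z)) (fullFibre W) :=
      hL.comp_contDiffOn (ih hf')
    exact h.congr fun z hz => (hd z hz).fderiv

theorem contDiffOn_curryI {W : Set (E × ℝ)} (hW : IsOpen W) {f : E × ℝ → F}
    (hf : ContDiffOn ℝ ∞ f W) : ContDiffOn ℝ ∞ (curryI f) (fullFibre W) :=
  contDiffOn_infty.2 fun n => contDiffOn_curryI_nat hW n (contDiffOn_infty.1 hf n)

end Curry

/-! ### Smooth sections of `x`-simple sets -/

section Section

theorem IsXSimple.ordConnected {U : Set (ℝ × ℝ)} (h : IsXSimple U) (t : ℝ) :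
    {x : ℝ | (t, x) ∈ U}.OrdConnected := by
  obtain ⟨a, b, hab⟩ := h t
  rw [hab]
  refine ⟨fun x hx y hy z hz => ⟨hx.1.trans_le ?_, lt_of_le_of_lt ?_ hy.2⟩⟩
  · exact EReal.coe_le_coe_iff.2 hz.1
  · exact EReal.coe_le_coe_iff.2 hz.2

theorem IsXSimple.mem_of_mem_Icc {U : Set (ℝ × ℝ)} (h : IsXSimple U) {t x y z : ℝ}
    (hx : (t, x) ∈ U) (hy : (t, y) ∈ U) (h1 : x ≤ z) (h2 : z ≤ y) : (t, z) ∈ U :=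
  (h.ordConnected t).out hx hy ⟨h1, h2⟩

/-- Smooth centre and radius of intervals in the slices of an `x`-simple open set. -/
theorem exists_smooth_section {Ω : Opens (ℝ × ℝ)} (hΩ : IsXSimple (Ω : Set (ℝ × ℝ))) :
    ∃ c e : ℝ → ℝ, ContDiffOn ℝ ∞ c (prT Ω) ∧ ContDiffOn ℝ ∞ e (prT Ω) ∧
      ∀ t ∈ prT Ω, 0 < e t ∧ ∀ x, |x - c t| ≤ e t → (t, x) ∈ Ω := by
  -- Admissible pairs (centre, radius). Only the end points are required to lie in `Ω`, as the slice
  -- is an interval. They are linear in the pair, so `T t` is convex; openness of `Ω` gives locally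
  -- constant choices, which a partition of unity glues.
  let T : prT Ω → Set (ℝ × ℝ) := fun t =>
    {q | 0 < q.2 ∧ ((t : ℝ), q.1 - q.2) ∈ Ω ∧ ((t : ℝ), q.1 + q.2) ∈ Ω}
  have hconv : ∀ t, Convex ℝ (T t) := by
    intro t
    have hJ : Convex ℝ {x : ℝ | ((t : ℝ), x) ∈ (Ω : Set (ℝ × ℝ))} :=
      convex_iff_ordConnected.2 (hΩ.ordConnected t)
    refine (convex_halfSpace_gt (f := fun q : ℝ × ℝ => q.2) ⟨by simp, by simp⟩ 0).inter
      (Convex.inter ?_ ?_)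
    · exact hJ.is_linear_preimage (f := fun q : ℝ × ℝ => q.1 - q.2)
        ⟨fun x y => by simp; ring, fun a x => by simp; ring⟩
    · exact hJ.is_linear_preimage (f := fun q : ℝ × ℝ => q.1 + q.2)
        ⟨fun x y => by simp; ring, fun a x => by simp; ring⟩
  have hloc : ∀ t : prT Ω, ∃ q : ℝ × ℝ, ∀ᶠ s in 𝓝 t, q ∈ T s := by
    rintro ⟨t, ⟨t', x⟩, hx, rfl⟩
    obtain ⟨δ, hδ, hb⟩ := Metric.isOpen_iff.1 Ω.isOpen _ hx
    refine ⟨(x, δ / 2), ?_⟩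
    have : ∀ᶠ s : prT Ω in 𝓝 ⟨t', mem_prT hx⟩, dist (s : ℝ) t' < δ :=
      continuous_subtype_val.continuousAt.eventually (Metric.ball_mem_nhds _ hδ)
    filter_upwards [this] with s hs
    refine ⟨half_pos hδ, hb ?_, hb ?_⟩ <;>
    · rw [Metric.mem_ball, Prod.dist_eq]
      refine max_lt hs ?_
      simp [abs_of_pos hδ, hδ]
  have : SigmaCompactSpace (prT Ω) := by
    have : LocallyCompactSpace (prT Ω) := (prT Ω).isOpen.locallyCompactSpace
    infer_instance
  obtain ⟨g, hg⟩ := exists_contMDiffMap_forall_mem_convex_of_local_const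
    (n := ⊤) 𝓘(ℝ, ℝ) hconv hloc
  classical
  let G : ℝ → ℝ × ℝ := fun t => if h : t ∈ prT Ω then g ⟨t, h⟩ else 0
  have hG : ∀ t (h : t ∈ prT Ω), G t = g ⟨t, h⟩ := fun t h => dif_pos h
  have hGs : ContDiffOn ℝ ∞ G (prT Ω) := by
    intro t ht
    refine ContDiffAt.contDiffWithinAt ?_
    rw [← contMDiffAt_iff_contDiffAt]
    refine (contMDiffAt_subtype_iff (x := (⟨t, ht⟩ : prT Ω))).1 ?_
    exact (g.contMDiff.contMDiffAt).congr_of_eventuallyEq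
      (Eventually.of_forall fun s => hG s s.2)
  refine ⟨fun t => (G t).1, fun t => (G t).2, contDiff_fst.comp_contDiffOn hGs,
    contDiff_snd.comp_contDiffOn hGs, fun t ht => ?_⟩
  obtain ⟨h1, h2, h3⟩ := hg ⟨t, ht⟩
  simp only [hG t ht]
  refine ⟨h1, fun x hx => ?_⟩
  rw [abs_le] at hx
  exact hΩ.mem_of_mem_Icc h2 h3 (by linarith [hx.1]) (by linarith [hx.2])

end Section

end DistODE

end

noncomputable section

namespace DistODE

open scoped unitInterval
open Filter Topology MeasureTheory

/-! ### Smoothness of the resolvent in the coefficient -/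

section Resolvent

variable {X : Type} [NormedRing X] [NormedAlgebra ℝ X]

/-- The solution of `g = 1 + V (B g)`. -/
def resolventOne (V : X →L[ℝ] X) (B : X) : X :=
  Ring.inverse (1 - V ∘L ContinuousLinearMap.mul ℝ X B) 1

theorem resolventOne_eq {V : X →L[ℝ] X} {B : X}
    (h : IsUnit (1 - V ∘L ContinuousLinearMap.mul ℝ X B)) :
    resolventOne V B = 1 + V (B * resolventOne V B) := by
  have h1 := congrArg (fun T : X →L[ℝ] X => T 1) (Ring.mul_inverse_cancel _ h)
  have h2 : resolventOne V B - V (B * resolventOne V B) = 1 := h1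
  exact sub_eq_iff_eq_add.1 h2

theorem eq_resolventOne {V : X →L[ℝ] X} {B g : X}
    (h : IsUnit (1 - V ∘L ContinuousLinearMap.mul ℝ X B)) (hg : g = 1 + V (B * g)) :
    g = resolventOne V B := by
  have h1 := congrArg (fun T : X →L[ℝ] X => T g) (Ring.inverse_mul_cancel _ h)
  have h2 : (1 - V ∘L ContinuousLinearMap.mul ℝ X B) g = 1 :=
    (show _ = g - V (B * g) from rfl).trans (sub_eq_iff_eq_add.2 hg)
  rw [resolventOne, ← h2]
  exact h1.symm

/-- The operator is affine in `B`, and inversion is smooth at units of a Banach algebra. This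
replaces a theorem on smooth dependence of solutions of differential equations on parameters. -/
theorem contDiffAt_resolventOne [CompleteSpace X] {V : X →L[ℝ] X} {B : X}
    (h : IsUnit (1 - V ∘L ContinuousLinearMap.mul ℝ X B)) :
    ContDiffAt ℝ ∞ (resolventOne V) B := by
  obtain ⟨u, hu⟩ := h
  have h1 : ContDiffAt ℝ ∞ (fun B : X => 1 - V ∘L ContinuousLinearMap.mul ℝ X B) B := by
    refine contDiffAt_const.sub (ContDiff.contDiffAt ?_)
    exact ((ContinuousLinearMap.compL ℝ X X X V) ∘L ContinuousLinearMap.mul ℝ X).contDiff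
  have h2 : ContDiffAt ℝ ∞ Ring.inverse (1 - V ∘L ContinuousLinearMap.mul ℝ X B) := by
    rw [← hu]
    exact contDiffAt_ringInverse ℝ u
  exact (h2.comp B h1).clm_apply contDiffAt_const

end Resolvent

/-! ### The Volterra operator on the unit interval -/

section Volterra

variable {F : Type} [NormedAddCommGroup F] [NormedSpace ℝ F]

/-- The primitive of a continuous function on the unit interval. -/
def volterraFun (g : C(I, F)) : C(I, F) where
  toFun s := ∫ r in (0 : ℝ)..s, Set.IccExtend zero_le_one g r
  continuous_toFun := (intervalIntegral.continuous_primitive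
    (fun _ _ => (g.continuous.Icc_extend' (h := zero_le_one)).intervalIntegrable _ _) 0).comp
      continuous_subtype_val

theorem volterraFun_apply_eq {g : C(I, F)} {h : ℝ → F} {s : I}
    (hh : ∀ r : I, r ≤ s → g r = h r) : volterraFun g s = ∫ r in (0 : ℝ)..s, h r := by
  refine intervalIntegral.integral_congr fun r hr => ?_
  rw [Set.uIcc_of_le s.2.1] at hr
  have hr' : r ∈ I := ⟨hr.1, hr.2.trans s.2.2⟩
  exact (Set.IccExtend_of_mem zero_le_one g hr').trans (hh ⟨r, hr'⟩ hr.2)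

theorem norm_volterraFun_apply_le {g : C(I, F)} {b : ℝ → ℝ} (hb : Continuous b) {s : I}
    (h : ∀ r : I, ‖g r‖ ≤ b r) : ‖volterraFun g s‖ ≤ ∫ r in (0 : ℝ)..s, b r := by
  refine intervalIntegral.norm_integral_le_of_norm_le s.2.1 (.of_forall fun r hr => ?_)
    (hb.intervalIntegrable _ _)
  have hr' : r ∈ I := ⟨hr.1.le, hr.2.trans s.2.2⟩
  rw [Set.IccExtend_of_mem zero_le_one g hr']
  exact h ⟨r, hr'⟩

/-- The primitive, as a linear map. -/
def volterraLM : C(I, F) →ₗ[ℝ] C(I, F) where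
  toFun := volterraFun
  map_add' f g := by
    ext s
    exact intervalIntegral.integral_add
      ((f.continuous.Icc_extend' (h := zero_le_one)).intervalIntegrable _ _)
      ((g.continuous.Icc_extend' (h := zero_le_one)).intervalIntegrable _ _)
  map_smul' c f := by
    ext s
    exact intervalIntegral.integral_smul c _

theorem norm_volterraLM_le (g : C(I, F)) : ‖volterraLM g‖ ≤ 1 * ‖g‖ := by
  refine (ContinuousMap.norm_le (volterraLM g) (by positivity)).2 fun s => ?_
  refine (norm_volterraFun_apply_le continuous_const fun r => g.norm_coe_le_norm r).trans ?_
  rw [intervalIntegral.integral_const, smul_eq_mul, sub_zero]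
  exact mul_le_mul_of_nonneg_right s.2.2 (norm_nonneg _)

/-- The primitive, as a continuous linear map. -/
def volterra : C(I, F) →L[ℝ] C(I, F) :=
  LinearMap.mkContinuous (E := C(I, F)) (F := C(I, F)) (𝕜 := ℝ) (𝕜₂ := ℝ)
    volterraLM 1 norm_volterraLM_le

variable {𝔸 : Type} [NormedRing 𝔸] [NormedAlgebra ℝ 𝔸]

/-- Each integration raises the power of `s` by one and divides by the new exponent; the pointwise
bound in `s` is what produces the factorial. -/
theorem norm_volterra_mul_pow_apply_le (B g : C(I, 𝔸)) (n : ℕ) (s : I) :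
    ‖((volterra ∘L ContinuousLinearMap.mul ℝ C(I, 𝔸) B) ^ n) g s‖ ≤
      ‖B‖ ^ n * ‖g‖ * ((s : ℝ) ^ n / n.factorial) := by
  induction n generalizing s with
  | zero => simpa using g.norm_coe_le_norm s
  | succ n ih =>
    rw [pow_succ']
    change ‖volterraFun (B * ((volterra ∘L ContinuousLinearMap.mul ℝ C(I, 𝔸) B) ^ n) g) s‖ ≤ _
    have hb : Continuous fun r : ℝ => ‖B‖ * (‖B‖ ^ n * ‖g‖ * (r ^ n / n.factorial)) := by
      fun_prop
    refine (norm_volterraFun_apply_le hb fun r => ?_).trans (le_of_eq ?_)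
    · refine (norm_mul_le _ _).trans (mul_le_mul (B.norm_coe_le_norm r) (ih r) (norm_nonneg _)
        (norm_nonneg _))
    · rw [intervalIntegral.integral_const_mul, intervalIntegral.integral_const_mul,
        intervalIntegral.integral_div, integral_pow, Nat.factorial_succ]
      have : (n.factorial : ℝ) ≠ 0 := by positivity
      have : (n + 1 : ℝ) ≠ 0 := by positivity
      push_cast
      field_simp
      ring

/-- Some power satisfies `‖T ^ n‖ < 1`, so `1 - T ^ n` is a unit, and `1 - T` is one of its
commuting factors by the geometric sum. No smallness of `B` is needed, so solutions exist along
whole fibres. -/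
theorem isUnit_one_sub_volterra_mul [CompleteSpace 𝔸] (B : C(I, 𝔸)) :
    IsUnit (1 - volterra ∘L ContinuousLinearMap.mul ℝ C(I, 𝔸) B) := by
  set T : C(I, 𝔸) →L[ℝ] C(I, 𝔸) := volterra ∘L ContinuousLinearMap.mul ℝ C(I, 𝔸) B
  obtain ⟨n, hn⟩ := ((FloorSemiring.tendsto_pow_div_factorial_atTop ‖B‖).eventually
    (gt_mem_nhds zero_lt_one)).exists
  have hTn : ‖T ^ n‖ < 1 := by
    refine lt_of_le_of_lt (ContinuousLinearMap.opNorm_le_bound _ (by positivity) fun g => ?_) hn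
    refine (ContinuousMap.norm_le _ (by positivity)).2 fun s => ?_
    refine (norm_volterra_mul_pow_apply_le B g n s).trans ?_
    have h1 : (s : ℝ) ^ n ≤ 1 := pow_le_one₀ s.2.1 s.2.2
    have h2 : (s : ℝ) ^ n / n.factorial ≤ 1 / n.factorial := by gcongr
    calc _ ≤ ‖B‖ ^ n * ‖g‖ * (1 / n.factorial) := by gcongr
      _ = _ := by ring
  have hu : IsUnit (1 - T ^ n) := (Units.oneSub (T ^ n) hTn).isUnit
  have e1 : (1 - T) * (∑ i ∈ Finset.range n, T ^ i) = 1 - T ^ n := mul_neg_geom_sum T n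
  have e2 : (∑ i ∈ Finset.range n, T ^ i) * (1 - T) = 1 - T ^ n := geom_sum_mul_neg T n
  rw [← e1] at hu
  exact ((Commute.isUnit_mul_iff (e1.trans e2.symm)).1 hu).1

end Volterra

end DistODE

end

noncomputable section

namespace DistODE

open scoped unitInterval
open Filter Topology MeasureTheory

/-! ### The flow along the fibres, starting from a smooth curve -/

section Transport

variable {Ω : Opens (ℝ × ℝ)} {c : ℝ → ℝ} {F : Type} [NormedAddCommGroup F] [NormedSpace ℝ F]

/-- The point dividing the segment from `(t, c t)` to `(t, x)` in the ratio `s : 1 - s`. -/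
def segPt (c : ℝ → ℝ) (q : (ℝ × ℝ) × ℝ) : ℝ × ℝ :=
  (q.1.1, c q.1.1 + q.2 * (q.1.2 - c q.1.1))

/-- The parameters for which the dividing point lies in `Ω`. -/
def segDom (Ω : Opens (ℝ × ℝ)) (c : ℝ → ℝ) : Set ((ℝ × ℝ) × ℝ) :=
  {q | q.1.1 ∈ prT Ω} ∩ segPt c ⁻¹' Ω

/-- The pullback of `g` to the segments, so that its integral over the unit interval is the
integral of `g` along the segment. -/
def segFun (c : ℝ → ℝ) (g : ℝ × ℝ → F) (q : (ℝ × ℝ) × ℝ) : F :=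
  (q.1.2 - c q.1.1) • g (segPt c q)

theorem contDiffOn_base (hc : ContDiffOn ℝ ∞ c (prT Ω)) :
    ContDiffOn ℝ ∞ (fun q : (ℝ × ℝ) × ℝ => c q.1.1) {q | q.1.1 ∈ prT Ω} :=
  hc.comp (contDiff_fst.comp contDiff_fst).contDiffOn fun _ h => h

theorem contDiffOn_segPt (hc : ContDiffOn ℝ ∞ c (prT Ω)) :
    ContDiffOn ℝ ∞ (segPt c) {q | q.1.1 ∈ prT Ω} := by
  have := contDiffOn_base hc
  have h1 : ContDiff ℝ ∞ fun q : (ℝ × ℝ) × ℝ => q.1.1 := by fun_prop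
  have h2 : ContDiff ℝ ∞ fun q : (ℝ × ℝ) × ℝ => q.1.2 := by fun_prop
  exact h1.contDiffOn.prodMk
    (this.add (contDiff_snd.contDiffOn.mul (h2.contDiffOn.sub this)))

theorem isOpen_segDom (hc : ContDiffOn ℝ ∞ c (prT Ω)) : IsOpen (segDom Ω c) :=
  (contDiffOn_segPt hc).continuousOn.isOpen_inter_preimage
    ((prT Ω).isOpen.preimage (continuous_fst.comp continuous_fst)) Ω.isOpen

theorem contDiffOn_segFun (hc : ContDiffOn ℝ ∞ c (prT Ω)) {g : ℝ × ℝ → F}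
    (hg : ContDiffOn ℝ ∞ g Ω) : ContDiffOn ℝ ∞ (segFun c g) (segDom Ω c) := by
  have h1 := (contDiffOn_base hc).mono (Set.inter_subset_left (t := segPt c ⁻¹' Ω))
  have h2 := hg.comp ((contDiffOn_segPt hc).mono (Set.inter_subset_left (t := segPt c ⁻¹' Ω)))
    Set.inter_subset_right
  have h3 : ContDiffOn ℝ ∞ (fun q : (ℝ × ℝ) × ℝ => q.1.2) (segDom Ω c) := by fun_prop
  exact (h3.sub h1).smul h2

theorem segPt_mem (hΩ : IsXSimple (Ω : Set (ℝ × ℝ))) (hcΩ : ∀ t ∈ prT Ω, (t, c t) ∈ Ω)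
    {z : ℝ × ℝ} (hz : z ∈ Ω) (s : I) : segPt c (z, s) ∈ Ω := by
  have h := hcΩ z.1 (mem_prT hz)
  rcases le_total (c z.1) z.2 with hle | hle
  · refine hΩ.mem_of_mem_Icc h hz ?_ ?_
    · nlinarith [s.2.1, s.2.2]
    · nlinarith [s.2.1, s.2.2]
  · refine hΩ.mem_of_mem_Icc hz h ?_ ?_
    · nlinarith [s.2.1, s.2.2]
    · nlinarith [s.2.1, s.2.2]

theorem subset_fullFibre_segDom (hΩ : IsXSimple (Ω : Set (ℝ × ℝ)))
    (hcΩ : ∀ t ∈ prT Ω, (t, c t) ∈ Ω) : (Ω : Set (ℝ × ℝ)) ⊆ fullFibre (segDom Ω c) :=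
  fun _ hz s => ⟨mem_prT hz, segPt_mem hΩ hcΩ hz s⟩

theorem integral_segFun (g : ℝ × ℝ → F) (z : ℝ × ℝ) :
    ∫ s in (0 : ℝ)..1, segFun c g (z, s) = ∫ y in c z.1..z.2, g (z.1, y) := by
  have := intervalIntegral.smul_integral_comp_add_mul (a := 0) (b := 1)
    (fun y => g (z.1, y)) (z.2 - c z.1) (c z.1)
  rw [← intervalIntegral.integral_smul] at this
  simp only [mul_zero, add_zero, mul_one, add_sub_cancel] at this
  rw [← this]
  refine intervalIntegral.integral_congr fun s _ => ?_
  simp only [segFun, segPt, mul_comm s]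

theorem contDiffOn_curryI_segFun (hΩ : IsXSimple (Ω : Set (ℝ × ℝ)))
    (hc : ContDiffOn ℝ ∞ c (prT Ω)) (hcΩ : ∀ t ∈ prT Ω, (t, c t) ∈ Ω) {g : ℝ × ℝ → F}
    (hg : ContDiffOn ℝ ∞ g Ω) : ContDiffOn ℝ ∞ (curryI (segFun c g)) Ω :=
  (contDiffOn_curryI (isOpen_segDom hc) (contDiffOn_segFun hc hg)).mono
    (subset_fullFibre_segDom hΩ hcΩ)

theorem curryI_segFun_apply (hΩ : IsXSimple (Ω : Set (ℝ × ℝ)))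
    (hc : ContDiffOn ℝ ∞ c (prT Ω)) (hcΩ : ∀ t ∈ prT Ω, (t, c t) ∈ Ω) {g : ℝ × ℝ → F}
    (hg : ContDiffOn ℝ ∞ g Ω) {z : ℝ × ℝ} (hz : z ∈ Ω) (s : I) :
    curryI (segFun c g) z s = segFun c g (z, s) :=
  curryI_apply (contDiffOn_segFun hc hg).continuousOn (subset_fullFibre_segDom hΩ hcΩ hz) s

/-- Integration from a smooth curve preserves smoothness. -/
theorem contDiffOn_primitive (hΩ : IsXSimple (Ω : Set (ℝ × ℝ)))
    (hc : ContDiffOn ℝ ∞ c (prT Ω)) (hcΩ : ∀ t ∈ prT Ω, (t, c t) ∈ Ω) {g : ℝ × ℝ → F}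
    (hg : ContDiffOn ℝ ∞ g Ω) :
    ContDiffOn ℝ ∞ (fun z : ℝ × ℝ => ∫ y in c z.1..z.2, g (z.1, y)) Ω := by
  -- After rescaling, the integral is a continuous linear functional of a curve in `C(I, F)` that
  -- depends smoothly on `z`.
  have hL : ContDiff ℝ ∞ fun h : C(I, F) => ContinuousMap.evalCLM ℝ (1 : I) (volterra h) := by
    fun_prop
  refine (hL.comp_contDiffOn (contDiffOn_curryI_segFun hΩ hc hcΩ hg)).congr fun z hz => ?_
  rw [← integral_segFun]
  exact (volterraFun_apply_eq (s := 1) fun r _ => curryI_segFun_apply hΩ hc hcΩ hg hz r).symm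

theorem hasDerivAt_primitive [CompleteSpace F] (hΩ : IsXSimple (Ω : Set (ℝ × ℝ)))
    {g : ℝ × ℝ → F} (hg : ContinuousOn g Ω) {t x y : ℝ} (hx : (t, x) ∈ Ω) (hy : (t, y) ∈ Ω) :
    HasDerivAt (fun w => ∫ u in y..w, g (t, u)) (g (t, x)) x := by
  set J : Set ℝ := {x | (t, x) ∈ Ω}
  have hJ : IsOpen J := Ω.isOpen.preimage (continuous_const.prodMk continuous_id)
  have hgJ : ContinuousOn (fun u => g (t, u)) J :=
    hg.comp (continuous_const.prodMk continuous_id).continuousOn fun _ h => h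
  refine intervalIntegral.integral_hasDerivAt_right ?_ ?_ (hgJ.continuousAt (hJ.mem_nhds hx))
  · exact (hgJ.mono ((hΩ.ordConnected t).uIcc_subset hy hx)).intervalIntegrable
  · exact hgJ.stronglyMeasurableAtFilter hJ x hx

variable {𝔸 : Type} [NormedRing 𝔸] [NormedAlgebra ℝ 𝔸]

/-- The solution of `Φ_x = a Φ` with `Φ = 1` on the curve `x = c t`. -/
def transport (c : ℝ → ℝ) (a : ℝ × ℝ → 𝔸) (z : ℝ × ℝ) : 𝔸 :=
  resolventOne volterra (curryI (segFun c a) z) 1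

variable [CompleteSpace 𝔸] {a : ℝ × ℝ → 𝔸}

theorem contDiffOn_transport (hΩ : IsXSimple (Ω : Set (ℝ × ℝ)))
    (hc : ContDiffOn ℝ ∞ c (prT Ω)) (hcΩ : ∀ t ∈ prT Ω, (t, c t) ∈ Ω)
    (ha : ContDiffOn ℝ ∞ a Ω) : ContDiffOn ℝ ∞ (transport c a) Ω := by
  have hL : ContDiff ℝ ∞ fun h : C(I, 𝔸) => ContinuousMap.evalCLM ℝ (1 : I) h := by
    fun_prop
  have hR : ContDiff ℝ ∞ (resolventOne (volterra (F := 𝔸))) :=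
    contDiff_iff_contDiffAt.2 fun B => contDiffAt_resolventOne (isUnit_one_sub_volterra_mul B)
  exact (hL.comp hR).comp_contDiffOn (contDiffOn_curryI_segFun hΩ hc hcΩ ha)

/-- The solution along the segment to `z`, reparametrised by `r ↦ s r`, satisfies the Volterra
equation of the shorter segment, so uniqueness identifies the two. The integrand in the equation at
`z` thus becomes `a` times `transport` itself, which yields `transport_eq_integral`. -/
theorem transport_segPt (hΩ : IsXSimple (Ω : Set (ℝ × ℝ)))
    (hc : ContDiffOn ℝ ∞ c (prT Ω)) (hcΩ : ∀ t ∈ prT Ω, (t, c t) ∈ Ω)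
    (ha : ContDiffOn ℝ ∞ a Ω) {z : ℝ × ℝ} (hz : z ∈ Ω) (s : I) :
    transport c a (segPt c (z, s)) = resolventOne volterra (curryI (segFun c a) z) s := by
  set B := curryI (segFun c a) z with hB
  set G := resolventOne volterra B
  let g : C(I, 𝔸) := G.comp ⟨fun r => s * r, by fun_prop⟩
  have hg : ∀ r, g r = G (s * r) := fun _ => rfl
  have hGeq : ∀ r, G r = 1 + volterraFun (B * G) r := fun r =>
    congrArg (fun h : C(I, 𝔸) => h r) (resolventOne_eq (isUnit_one_sub_volterra_mul B))
  have key : g = 1 + volterra (curryI (segFun c a) (segPt c (z, s)) * g) := by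
    ext r
    change g r = 1 + volterraFun _ r
    rw [hg, hGeq]
    congr 1
    let E : ℝ → 𝔸 := Set.IccExtend zero_le_one (B * G)
    have hE : ∀ r : I, (B * G) r = E r := fun r =>
      (Set.IccExtend_val zero_le_one (B * G) r).symm
    rw [volterraFun_apply_eq (h := E) fun r _ => hE r,
      volterraFun_apply_eq (h := fun r => (s : ℝ) • E (s * r)) fun r _ => ?_]
    · rw [intervalIntegral.integral_smul, intervalIntegral.smul_integral_comp_mul_left]
      simp
    · have h2 := hE (s * r)
      rw [Set.Icc.coe_mul] at h2
      rw [← h2, ContinuousMap.mul_apply, ContinuousMap.mul_apply, hg,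
        curryI_segFun_apply hΩ hc hcΩ ha (segPt_mem hΩ hcΩ hz s),
        hB, curryI_segFun_apply hΩ hc hcΩ ha hz, ← smul_mul_assoc]
      congr 1
      simp only [segFun, segPt, Set.Icc.coe_mul]
      rw [smul_smul]
      congr 2
      · ring
      · ring_nf
  have h3 : g 1 = transport c a (segPt c (z, s)) := congrArg (fun h : C(I, 𝔸) => h 1)
    (eq_resolventOne (isUnit_one_sub_volterra_mul (curryI (segFun c a) (segPt c (z, s)))) key)
  rw [← h3, hg, mul_one]

theorem transport_eq_integral (hΩ : IsXSimple (Ω : Set (ℝ × ℝ)))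
    (hc : ContDiffOn ℝ ∞ c (prT Ω)) (hcΩ : ∀ t ∈ prT Ω, (t, c t) ∈ Ω)
    (ha : ContDiffOn ℝ ∞ a Ω) {z : ℝ × ℝ} (hz : z ∈ Ω) :
    transport c a z = 1 + ∫ y in c z.1..z.2, a (z.1, y) * transport c a (z.1, y) := by
  have h1 : transport c a z = 1 + volterraFun (curryI (segFun c a) z *
      resolventOne volterra (curryI (segFun c a) z)) 1 :=
    congrArg (fun h : C(I, 𝔸) => h 1) (resolventOne_eq (isUnit_one_sub_volterra_mul _))
  rw [h1, ← integral_segFun (c := c) (fun z => a z * transport c a z)]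
  congr 1
  refine volterraFun_apply_eq (s := 1) fun r _ => ?_
  rw [ContinuousMap.mul_apply, curryI_segFun_apply hΩ hc hcΩ ha hz,
    ← transport_segPt hΩ hc hcΩ ha hz, segFun, segFun, smul_mul_assoc]

theorem transport_base (hΩ : IsXSimple (Ω : Set (ℝ × ℝ)))
    (hc : ContDiffOn ℝ ∞ c (prT Ω)) (hcΩ : ∀ t ∈ prT Ω, (t, c t) ∈ Ω)
    (ha : ContDiffOn ℝ ∞ a Ω) {t : ℝ} (ht : t ∈ prT Ω) : transport c a (t, c t) = 1 := by
  rw [transport_eq_integral hΩ hc hcΩ ha (hcΩ t ht), intervalIntegral.integral_same, add_zero]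

theorem hasDerivAt_transport (hΩ : IsXSimple (Ω : Set (ℝ × ℝ)))
    (hc : ContDiffOn ℝ ∞ c (prT Ω)) (hcΩ : ∀ t ∈ prT Ω, (t, c t) ∈ Ω)
    (ha : ContDiffOn ℝ ∞ a Ω) {t x : ℝ} (hx : (t, x) ∈ Ω) :
    HasDerivAt (fun y => transport c a (t, y)) (a (t, x) * transport c a (t, x)) x := by
  have h1 := (hasDerivAt_primitive hΩ (g := fun z => a z * transport c a z)
    (ha.continuousOn.mul (contDiffOn_transport hΩ hc hcΩ ha).continuousOn) hx
    (hcΩ t (mem_prT hx))).const_add 1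
  refine h1.congr_of_eventuallyEq ?_
  have hJ : IsOpen {x | (t, x) ∈ Ω} := Ω.isOpen.preimage (continuous_const.prodMk continuous_id)
  filter_upwards [hJ.mem_nhds hx] with y hy
  exact transport_eq_integral hΩ hc hcΩ ha hy

end Transport

end DistODE

end

noncomputable section

namespace DistODE

open Filter Topology MeasureTheory

/-! ### Classical solutions and fundamental matrices -/

section MatrixSolutions

attribute [local instance] Matrix.linftyOpNormedRing Matrix.linftyOpNormedAlgebra

variable {p : ℕ} {Ω : Opens (ℝ × ℝ)} {A Φ Ψ N : ℝ × ℝ → Matrix (Fin p) (Fin p) ℝ}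

/-- The entry of a matrix, as a continuous linear map. -/
def entryCLM (i j : Fin p) : Matrix (Fin p) (Fin p) ℝ →L[ℝ] ℝ :=
  LinearMap.toContinuousLinearMap (Matrix.entryLinearMap ℝ ℝ i j)

/-- Passes between entrywise smoothness and smoothness in the normed algebra of matrices in which
`transport` is built. -/
theorem smoothMatrixOn_iff {M : ℝ × ℝ → Matrix (Fin p) (Fin p) ℝ} :
    SmoothMatrixOn Ω M ↔ ContDiffOn ℝ ∞ M Ω := by
  refine ⟨fun h => ?_, fun h i j => (entryCLM i j).contDiff.comp_contDiffOn h⟩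
  have e : M = fun z => ∑ i, ∑ j, M z i j • Matrix.single i j (1 : ℝ) := by
    funext z
    conv_lhs => rw [Matrix.matrix_eq_sum_single (M z)]
    simp [Matrix.smul_single]
  rw [e]
  exact ContDiffOn.sum fun i _ => ContDiffOn.sum fun j _ => (h i j).smul contDiffOn_const

theorem SmoothMatrixOn.transpose {M : ℝ × ℝ → Matrix (Fin p) (Fin p) ℝ}
    (h : SmoothMatrixOn Ω M) : SmoothMatrixOn Ω fun z => (M z).transpose := fun i j => h j i

theorem SmoothMatrixOn.mul {M N : ℝ × ℝ → Matrix (Fin p) (Fin p) ℝ} (hM : SmoothMatrixOn Ω M)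
    (hN : SmoothMatrixOn Ω N) : SmoothMatrixOn Ω fun z => M z * N z :=
  smoothMatrixOn_iff.2 ((smoothMatrixOn_iff.1 hM).mul (smoothMatrixOn_iff.1 hN))

theorem SmoothMatrixOn.neg {M : ℝ × ℝ → Matrix (Fin p) (Fin p) ℝ} (hM : SmoothMatrixOn Ω M) :
    SmoothMatrixOn Ω fun z => -M z := fun i j => (hM i j).neg

theorem SmoothMatrixOn.contDiffOn_mulVec {M : ℝ × ℝ → Matrix (Fin p) (Fin p) ℝ}
    (hM : SmoothMatrixOn Ω M) {v : ℝ × ℝ → Fin p → ℝ} (hv : ContDiffOn ℝ ∞ v Ω) :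
    ContDiffOn ℝ ∞ (fun z => (M z).mulVec (v z)) Ω :=
  contDiffOn_pi.2 fun i =>
    (ContDiffOn.sum fun j _ => (hM i j).mul (contDiffOn_pi.1 hv j) :
      ContDiffOn ℝ ∞ (fun z => ∑ j, M z i j * v z j) Ω)

theorem SmoothMatrixOn.continuousOn_mulVec {M : ℝ × ℝ → Matrix (Fin p) (Fin p) ℝ}
    (hM : SmoothMatrixOn Ω M) {v : ℝ × ℝ → Fin p → ℝ} (hv : ContinuousOn v Ω) :
    ContinuousOn (fun z => (M z).mulVec (v z)) Ω :=
  continuousOn_pi.2 fun i =>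
    (continuousOn_finsetSum _ fun j _ => (hM i j).continuousOn.mul (continuousOn_pi.1 hv j) :
      ContinuousOn (fun z => ∑ j, M z i j * v z j) Ω)

/-- `Φ_x = A Φ`. -/
def IsLeftFlow (Ω : Opens (ℝ × ℝ)) (A Φ : ℝ × ℝ → Matrix (Fin p) (Fin p) ℝ) : Prop :=
  ∀ t x : ℝ, (t, x) ∈ Ω → ∀ i j,
    HasDerivAt (fun y => Φ (t, y) i j) ((A (t, x) * Φ (t, x)) i j) x

/-- `Ψ_x = -Ψ A`. -/
def IsRightFlow (Ω : Opens (ℝ × ℝ)) (A Ψ : ℝ × ℝ → Matrix (Fin p) (Fin p) ℝ) : Prop :=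
  ∀ t x : ℝ, (t, x) ∈ Ω → ∀ i j,
    HasDerivAt (fun y => Ψ (t, y) i j) (-(Ψ (t, x) * A (t, x)) i j) x

theorem isOpen_slice (t : ℝ) : IsOpen {x | (t, x) ∈ Ω} :=
  Ω.isOpen.preimage (continuous_const.prodMk continuous_id)

theorem eq_of_hasDerivAt_zero (hΩ : IsXSimple (Ω : Set (ℝ × ℝ))) {f : ℝ × ℝ → ℝ} {t : ℝ}
    (hf : ∀ x, (t, x) ∈ Ω → HasDerivAt (fun y => f (t, y)) 0 x) {x y : ℝ} (hx : (t, x) ∈ Ω)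
    (hy : (t, y) ∈ Ω) : f (t, x) = f (t, y) := by
  refine (isOpen_slice (Ω := Ω) t).is_const_of_deriv_eq_zero (f := fun x => f (t, x))
    (hΩ.ordConnected t).isPreconnected
    (fun x hx => (hf x hx).differentiableAt.differentiableWithinAt)
    (fun x hx => (hf x hx).deriv) hx hy

theorem hasDerivAt_mulVec {M M' : ℝ → Matrix (Fin p) (Fin p) ℝ} {v v' : ℝ → Fin p → ℝ} {x : ℝ}
    (hM : ∀ i j, HasDerivAt (fun y => M y i j) (M' x i j) x) (hv : HasDerivAt v (v' x) x) :
    HasDerivAt (fun y => (M y).mulVec (v y)) ((M' x).mulVec (v x) + (M x).mulVec (v' x)) x := by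
  refine hasDerivAt_pi.2 fun i => ?_
  have := HasDerivAt.fun_sum (u := Finset.univ) fun j _ =>
    (hM i j).mul (hasDerivAt_pi.1 hv j)
  simpa [Matrix.mulVec, dotProduct, Finset.sum_add_distrib] using this

/-- Pairs of mutually inverse smooth flows. -/
theorem exists_flows (hΩ : IsXSimple (Ω : Set (ℝ × ℝ))) (hA : SmoothMatrixOn Ω A) :
    ∃ Φ Ψ : ℝ × ℝ → Matrix (Fin p) (Fin p) ℝ, SmoothMatrixOn Ω Φ ∧ SmoothMatrixOn Ω Ψ ∧
      IsLeftFlow Ω A Φ ∧ IsRightFlow Ω A Ψ ∧ (∀ z ∈ Ω, Ψ z * Φ z = 1) ∧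
      ∀ z ∈ Ω, Φ z * Ψ z = 1 := by
  obtain ⟨c, e, hc, -, hce⟩ := exists_smooth_section hΩ
  have hcΩ : ∀ t ∈ prT Ω, (t, c t) ∈ Ω := fun t ht =>
    (hce t ht).2 _ (by simpa using (hce t ht).1.le)
  have : CompleteSpace (Matrix (Fin p) (Fin p) ℝ) := FiniteDimensional.complete ℝ _
  have hA' := smoothMatrixOn_iff.1 hA
  have hB' := smoothMatrixOn_iff.1 hA.transpose.neg
  -- Transposing a solution of `Y_x = -Aᵀ Y` gives `Ψ_x = -Ψ A`. Then `Ψ Φ` has zero `x`-derivative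
  -- and equals `1` on the curve.
  set B : ℝ × ℝ → Matrix (Fin p) (Fin p) ℝ := fun z => -(A z).transpose
  have hΦs := smoothMatrixOn_iff.2 (contDiffOn_transport hΩ hc hcΩ hA')
  have hΨs := (smoothMatrixOn_iff.2 (contDiffOn_transport hΩ hc hcΩ hB')).transpose
  have hΦ : IsLeftFlow Ω A (transport c A) := fun t x hx i j =>
    (entryCLM i j).hasFDerivAt.comp_hasDerivAt x (hasDerivAt_transport hΩ hc hcΩ hA' hx)
  have hΨ : IsRightFlow Ω A (fun z => (transport c B z).transpose) := fun t x hx i j => by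
    have h := (entryCLM j i).hasFDerivAt.comp_hasDerivAt x
      (hasDerivAt_transport hΩ hc hcΩ hB' hx)
    have e : ∀ M T : Matrix (Fin p) (Fin p) ℝ, (-M.transpose * T) j i =
        -(T.transpose * M) i j := fun M T => by
      rw [neg_mul, Matrix.neg_apply, ← Matrix.transpose_apply (_ * T), Matrix.transpose_mul,
        Matrix.transpose_transpose]
    exact h.congr_deriv (e _ _)
  have h1 : ∀ z ∈ Ω, (transport c B z).transpose * transport c A z = 1 := by
    rintro ⟨t, x⟩ hz
    have ht := mem_prT hz
    have hbase : (transport c B (t, c t)).transpose * transport c A (t, c t) = 1 := by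
      rw [transport_base hΩ hc hcΩ hA' ht, transport_base hΩ hc hcΩ hB' ht,
        Matrix.transpose_one, mul_one]
    rw [← hbase]
    ext i j
    refine eq_of_hasDerivAt_zero hΩ
      (f := fun z => ((transport c B z).transpose * transport c A z) i j) (fun x hx => ?_) hz
      (hcΩ t ht)
    have := HasDerivAt.fun_sum (u := Finset.univ) fun k _ => (hΨ t x hx i k).mul (hΦ t x hx k j)
    refine (this.congr_deriv ?_)
    rw [Finset.sum_add_distrib]
    simp only [neg_mul, Finset.sum_neg_distrib]
    rw [← Matrix.mul_apply, ← Matrix.mul_apply, mul_assoc, neg_add_cancel]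
  exact ⟨_, _, hΦs, hΨs, hΦ, hΨ, h1, fun z hz => mul_eq_one_comm.1 (h1 z hz)⟩

theorem IsLeftFlow.isSolution_mulVec (hΦs : SmoothMatrixOn Ω Φ) (hA : SmoothMatrixOn Ω A)
    (hΦ : IsLeftFlow Ω A Φ) (w : Fin p → ℝ) :
    IsSolution Ω A 0 fun z => (Φ z).mulVec w := by
  have hd : ∀ t x : ℝ, (t, x) ∈ Ω → HasDerivAt (fun y => (Φ (t, y)).mulVec w)
      ((A (t, x)).mulVec ((Φ (t, x)).mulVec w) + 0) x := by
    intro t x hx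
    refine (hasDerivAt_mulVec (M' := fun _ => A (t, x) * Φ (t, x)) (hΦ t x hx)
      (v' := fun _ => 0) (hasDerivAt_const x w)).congr_deriv ?_
    simp
  refine ⟨⟨hΦs.continuousOn_mulVec continuousOn_const, _,
    hA.continuousOn_mulVec (hΦs.continuousOn_mulVec (v := fun _ => w) continuousOn_const),
    fun t x hx => ?_⟩, hd⟩
  simpa using hd t x hx

/-- Variation of constants: `ψ = Φ ∫ Φ⁻¹ F`, integrated in `x` from the smooth curve so that `ψ` is
smooth in `t` as well. -/
theorem exists_smooth_solution (hΩ : IsXSimple (Ω : Set (ℝ × ℝ))) (hA : SmoothMatrixOn Ω A)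
    {F : ℝ × ℝ → Fin p → ℝ} (hF : ContDiffOn ℝ ∞ F Ω) :
    ∃ ψ : ℝ × ℝ → Fin p → ℝ, ContDiffOn ℝ ∞ ψ Ω ∧ IsSolution Ω A F ψ := by
  obtain ⟨c, e, hc, -, hce⟩ := exists_smooth_section hΩ
  have hcΩ : ∀ t ∈ prT Ω, (t, c t) ∈ Ω := fun t ht =>
    (hce t ht).2 _ (by simpa using (hce t ht).1.le)
  obtain ⟨Φ, Ψ, hΦs, hΨs, hΦ, -, -, hΦΨ⟩ := exists_flows hΩ hA
  have hg := hΨs.contDiffOn_mulVec hF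
  have hP := contDiffOn_primitive hΩ hc hcΩ hg
  set P : ℝ × ℝ → Fin p → ℝ := fun z => ∫ y in c z.1..z.2, (Ψ (z.1, y)).mulVec (F (z.1, y))
  have hψ := hΦs.contDiffOn_mulVec hP
  have hd : ∀ t x : ℝ, (t, x) ∈ Ω → HasDerivAt (fun y => (Φ (t, y)).mulVec (P (t, y)))
      ((A (t, x)).mulVec ((Φ (t, x)).mulVec (P (t, x))) + F (t, x)) x := by
    intro t x hx
    have h1 : HasDerivAt (fun y => P (t, y)) ((Ψ (t, x)).mulVec (F (t, x))) x :=
      hasDerivAt_primitive hΩ hg.continuousOn hx (hcΩ t (mem_prT hx))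
    refine (hasDerivAt_mulVec (M' := fun _ => A (t, x) * Φ (t, x)) (hΦ t x hx)
      (v' := fun _ => (Ψ (t, x)).mulVec (F (t, x))) h1).congr_deriv ?_
    rw [Matrix.mulVec_mulVec _ (Φ (t, x)) (Ψ (t, x)), hΦΨ _ hx, Matrix.one_mulVec,
      Matrix.mulVec_mulVec]
  exact ⟨_, hψ, ⟨hψ.continuousOn, _, (hA.continuousOn_mulVec hψ.continuousOn).add hF.continuousOn,
    hd⟩, hd⟩

/-- For a solution `v`, the product `Ψ v` is constant on each fibre. Its value on the curve is the
coefficient `ζ`, continuous because the curve is, and unique since `Ψ Φ = 1`. -/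
theorem isFundamentalMatrix_of_flows (hΩ : IsXSimple (Ω : Set (ℝ × ℝ)))
    (hA : SmoothMatrixOn Ω A) (hΦs : SmoothMatrixOn Ω Φ) (hΨs : SmoothMatrixOn Ω Ψ)
    (hΦ : IsLeftFlow Ω A Φ) (hΨ : IsRightFlow Ω A Ψ) (hΨΦ : ∀ z ∈ Ω, Ψ z * Φ z = 1)
    (hΦΨ : ∀ z ∈ Ω, Φ z * Ψ z = 1) : IsFundamentalMatrix Ω A Φ := by
  obtain ⟨c, e, hc, -, hce⟩ := exists_smooth_section hΩ
  have hcΩ : ∀ t ∈ prT Ω, (t, c t) ∈ Ω := fun t ht =>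
    (hce t ht).2 _ (by simpa using (hce t ht).1.le)
  refine ⟨fun i j => ⟨(hΦs i j).continuousOn, _, ((hA.mul hΦs) i j).continuousOn,
    fun t x hx => hΦ t x hx i j⟩, hΦ, fun v hv => ?_⟩
  have hcont : ContinuousOn (fun z => (Ψ z).mulVec (v z)) Ω := hΨs.continuousOn_mulVec hv.1.1
  have hconst : ∀ t x y : ℝ, (t, x) ∈ Ω → (t, y) ∈ Ω →
      (Ψ (t, x)).mulVec (v (t, x)) = (Ψ (t, y)).mulVec (v (t, y)) := by
    intro t x y hx hy
    funext i
    refine eq_of_hasDerivAt_zero hΩ (f := fun z => (Ψ z).mulVec (v z) i) (fun x hx => ?_) hx hy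
    have h := hasDerivAt_mulVec (M' := fun _ => -(Ψ (t, x) * A (t, x))) (hΨ t x hx)
      (v' := fun _ => (A (t, x)).mulVec (v (t, x)) + 0) (hv.2 t x hx)
    refine (hasDerivAt_pi.1 h i).congr_deriv ?_
    simp [Matrix.neg_mulVec]
  let ζ : C(prT Ω, Fin p → ℝ) :=
    ⟨fun t => (Ψ (t, c t)).mulVec (v (t, c t)),
      hcont.comp_continuous (f := fun t : prT Ω => ((t : ℝ), c t))
        (continuous_subtype_val.prodMk (continuousOn_iff_continuous_domRestrict.1 hc.continuousOn))
        fun t => hcΩ t t.2⟩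
  refine ⟨ζ, fun t x hx => ?_, fun ζ' hζ' => ?_⟩
  · change _ = (Φ (t, x)).mulVec ((Ψ (t, c t)).mulVec (v (t, c t)))
    rw [← hconst t x (c t) hx (hcΩ t (mem_prT hx)), Matrix.mulVec_mulVec, hΦΨ _ hx,
      Matrix.one_mulVec]
  · ext1 ⟨t, ht⟩
    change _ = (Ψ (t, c t)).mulVec (v (t, c t))
    rw [hζ' t (c t) (hcΩ t ht), Matrix.mulVec_mulVec, hΨΦ _ (hcΩ t ht), Matrix.one_mulVec]

/-- A smooth fundamental matrix has a smooth inverse, which is a right flow. -/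
theorem IsFundamentalMatrix.exists_inverse (hΩ : IsXSimple (Ω : Set (ℝ × ℝ)))
    (hA : SmoothMatrixOn Ω A) (hΦs : SmoothMatrixOn Ω Φ) (hΦ : IsFundamentalMatrix Ω A Φ) :
    ∃ N : ℝ × ℝ → Matrix (Fin p) (Fin p) ℝ, SmoothMatrixOn Ω N ∧ IsRightFlow Ω A N ∧
      ∀ z ∈ Ω, Φ z * N z = 1 := by
  obtain ⟨Φ₀, Ψ, hΦ₀s, hΨs, hΦ₀, hΨ, -, hΦΨ⟩ := exists_flows hΩ hA
  -- The columns of the invertible flow `Φ₀` are solutions, so `Φ₀ = Φ Z` with `Z` depending on `t`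
  -- alone; then `Z Ψ` is a right inverse of `Φ`.
  have hsol : ∀ j, ∃ ζ : C(prT Ω, Fin p → ℝ), ∀ (t x : ℝ) (h : (t, x) ∈ Ω),
      (Φ₀ (t, x)).mulVec (Pi.single j 1) = (Φ (t, x)).mulVec (ζ ⟨t, mem_prT h⟩) := fun j =>
    (hΦ.existsUnique _ (hΦ₀.isSolution_mulVec hΦ₀s hA (Pi.single j 1))).exists
  choose ζ hζ using hsol
  classical
  let Z : ℝ → Matrix (Fin p) (Fin p) ℝ := fun t =>
    if h : t ∈ prT Ω then Matrix.of fun i j => ζ j ⟨t, h⟩ i else 0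
  have hZ : ∀ t x : ℝ, (t, x) ∈ Ω → Φ₀ (t, x) = Φ (t, x) * Z t := by
    intro t x hx
    ext i j
    have h := congrFun (hζ j t x hx) i
    rw [Matrix.mulVec_single_one] at h
    have e : Z t = Matrix.of fun i j => ζ j ⟨t, mem_prT hx⟩ i := dif_pos (mem_prT hx)
    rw [e]
    exact h
  let N : ℝ × ℝ → Matrix (Fin p) (Fin p) ℝ := fun z => Z z.1 * Ψ z
  have hN : ∀ z ∈ Ω, Φ z * N z = 1 := by
    rintro ⟨t, x⟩ hx
    rw [← mul_assoc, ← hZ t x hx, hΦΨ _ hx]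
  refine ⟨N, smoothMatrixOn_iff.2 fun z hz => ?_, fun t x hx i j => ?_, hN⟩
  -- The definition of `N` does not show smoothness, as `Z` comes from coefficients that are merely
  -- continuous. It follows instead from `N = Φ⁻¹` with `Φ` smooth.
  · have : CompleteSpace (Matrix (Fin p) (Fin p) ℝ) := FiniteDimensional.complete ℝ _
    have hu : IsUnit (Φ z) :=
      ⟨⟨Φ z, N z, hN z hz, mul_eq_one_comm.1 (hN z hz)⟩, rfl⟩
    obtain ⟨u, hu⟩ := hu
    have h1 : ContDiffAt ℝ ∞ Ring.inverse (Φ z) := hu ▸ contDiffAt_ringInverse ℝ u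
    have h2 := h1.comp_contDiffWithinAt z (smoothMatrixOn_iff.1 hΦs z hz)
    have e : ∀ y ∈ Ω, N y = Ring.inverse (Φ y) := fun y hy => by
      rw [← Matrix.nonsing_inv_eq_ringInverse]
      exact (Matrix.inv_eq_right_inv (hN y hy)).symm
    exact h2.congr e (e z hz)
  -- `Z` is constant in `x`, so `N` inherits the equation of `Ψ`.
  · have := HasDerivAt.fun_sum (u := Finset.univ) fun k _ => (hΨ t x hx k j).const_mul (Z t i k)
    refine this.congr_deriv ?_
    simp only [mul_neg, Finset.sum_neg_distrib]
    rw [← Matrix.mul_apply, ← mul_assoc]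

end MatrixSolutions

end DistODE

end

noncomputable section

namespace DistODE

open MeasureTheory

/-! ### Products of smooth functions and distributions -/

section Products

variable {E : Type*} [NormedAddCommGroup E] [NormedSpace ℝ E] {Ω : Opens E} {a b : E → ℝ}

theorem testFunction_eq_zero (f : 𝓓(Ω, ℝ)) {z : E} (hz : z ∉ Ω) : f z = 0 :=
  image_eq_zero_of_notMem_tsupport fun h => hz (f.tsupport_subset h)

/-- Coefficients are controlled only on `Ω`, so identities between multiplied test functions have to
be checked there alone. -/
theorem testFunction_ext {f g : 𝓓(Ω, ℝ)} (h : ∀ z ∈ Ω, f z = g z) : f = g := by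
  ext z
  by_cases hz : z ∈ Ω
  · exact h z hz
  · rw [testFunction_eq_zero f hz, testFunction_eq_zero g hz]

theorem lineDeriv_test_apply (m : E) (f : 𝓓(Ω, ℝ)) (z : E) : (∂_{m} f) z = fderiv ℝ f z m := by
  rw [← (f.contDiff.differentiable (by simp) z).lineDeriv_eq_fderiv]
  exact TestFunction.lineDerivCLM_apply_of_le (𝕜 := ℝ) le_top

/-- The product rule. -/
theorem lineDeriv_smulDistr {m : E} (ha : ContDiffOn ℝ ∞ a Ω) (hb : ContDiffOn ℝ ∞ b Ω)
    (h : ∀ z ∈ Ω, fderiv ℝ a z m = b z) (T : 𝓓'(Ω, ℝ)) :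
    ∂_{m} (smulDistr a ha T) = smulDistr b hb T + smulDistr a ha (∂_{m} T) := by
  ext f
  change ∂_{m} (smulDistr a ha T) f = T (mulTest b hb f) + ∂_{m} T (mulTest a ha f)
  rw [Distribution.lineDerivOp_apply_apply, Distribution.lineDerivOp_apply_apply,
    smulDistr_apply, ← map_add]
  congr 1
  refine testFunction_ext fun z hz => ?_
  have hda : DifferentiableAt ℝ a z :=
    (ha.differentiableOn (by simp)).differentiableAt (Ω.isOpen.mem_nhds hz)
  have hdf : DifferentiableAt ℝ f z := f.contDiff.differentiable (by simp) z
  have e : fderiv ℝ (mulTest a ha f) z m = a z * fderiv ℝ f z m + f z * b z := by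
    have : (mulTest a ha f : E → ℝ) = fun z => a z * f z := rfl
    rw [this, fderiv_fun_mul hda hdf, ← h z hz]
    rfl
  -- By duality the product rule has become an identity between test functions.
  change a z * -(∂_{m} f) z = b z * f z + -(∂_{m} (mulTest a ha f)) z
  rw [lineDeriv_test_apply, lineDeriv_test_apply, e]
  ring

end Products

/-! ### Regular distributions as multiples of `T_1` -/

section RegularOne

variable {E : Type*} [NormedAddCommGroup E] [NormedSpace ℝ E] [MeasureSpace E] [BorelSpace E]
  [IsLocallyFiniteMeasure (volume : Measure E)] {Ω : Opens E}

theorem regularDistr_one_apply (f : 𝓓(Ω, ℝ)) :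
    (regularDistr (fun _ => 1) : 𝓓'(Ω, ℝ)) f = ∫ z, f z := by
  rw [regularDistr_apply]
  · simp
  · exact (locallyIntegrable_const (1 : ℝ)).locallyIntegrableOn _

/-- Lets derivatives of regular distributions be computed by the product rule, as `T_1` has zero
derivative. -/
theorem regularDistr_eq_smulDistr [SecondCountableTopology E] {g : E → ℝ}
    (hg : ContDiffOn ℝ ∞ g Ω) :
    (regularDistr g : 𝓓'(Ω, ℝ)) = smulDistr g hg (regularDistr fun _ => 1) := by
  ext f
  rw [regularDistr_apply, smulDistr_apply, regularDistr_one_apply]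
  · exact integral_congr_ae (.of_forall fun z => mul_comm _ _)
  · exact hg.continuousOn.locallyIntegrableOn Ω.isOpen.measurableSet

-- Integration by parts against the constant function one.
omit [IsLocallyFiniteMeasure (volume : Measure E)] in
theorem integral_lineDeriv_test [FiniteDimensional ℝ E]
    [(volume : Measure E).IsAddHaarMeasure] (m : E) (f : 𝓓(Ω, ℝ)) :
    ∫ z, (∂_{m} f) z = 0 := by
  have h := integral_mul_fderiv_eq_neg_fderiv_mul_of_integrable (μ := (volume : Measure E))
    (𝕜 := ℝ) (f := fun _ : E => (1 : ℝ)) (g := f) (v := m) ?_ ?_ ?_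
    (fun _ _ => differentiableAt_const _) (fun z _ => f.contDiff.differentiable (by simp) z)
  · simpa [lineDeriv_test_apply] using h
  · simp
  · have := (∂_{m} f).continuous.integrable_of_hasCompactSupport (∂_{m} f).hasCompactSupport
      (μ := (volume : Measure E))
    exact this.congr (.of_forall fun z => by simp only [one_mul, lineDeriv_test_apply])
  · simpa only [one_mul] using f.continuous.integrable_of_hasCompactSupport f.hasCompactSupport
      (μ := (volume : Measure E))

theorem lineDeriv_regularDistr_one [FiniteDimensional ℝ E]
    [(volume : Measure E).IsAddHaarMeasure] (m : E) :
    ∂_{m} (regularDistr (fun _ => 1) : 𝓓'(Ω, ℝ)) = 0 := by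
  ext f
  rw [Distribution.lineDerivOp_apply_apply, map_neg, regularDistr_one_apply,
    integral_lineDeriv_test, neg_zero]
  rfl

end RegularOne

/-! ### Matrix calculus for vector distributions -/

section MatrixProducts

variable {p : ℕ} {Ω : Opens (ℝ × ℝ)} {M M' N : ℝ × ℝ → Matrix (Fin p) (Fin p) ℝ}

theorem mulVecDistr_apply (hM : SmoothMatrixOn Ω M) (v : Fin p → 𝓓'(Ω, ℝ)) (i : Fin p)
    (f : 𝓓(Ω, ℝ)) : mulVecDistr M hM v i f = ∑ j, v j (mulTest (fun z => M z i j) (hM i j) f) := by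
  simp [mulVecDistr]

theorem testFunction_sum_apply {ι : Type*} (s : Finset ι) (f : ι → 𝓓(Ω, ℝ)) (z : ℝ × ℝ) :
    (∑ i ∈ s, f i) z = ∑ i ∈ s, f i z := by
  induction s using Finset.cons_induction with
  | empty => rfl
  | cons a s ha ih => rw [Finset.sum_cons, Finset.sum_cons, ← ih]; rfl

theorem mulVecDistr_mulVecDistr (hM : SmoothMatrixOn Ω M) (hN : SmoothMatrixOn Ω N)
    (v : Fin p → 𝓓'(Ω, ℝ)) :
    mulVecDistr M hM (mulVecDistr N hN v) = mulVecDistr _ (hM.mul hN) v := by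
  funext i
  ext f
  simp only [mulVecDistr_apply]
  rw [Finset.sum_comm]
  refine Finset.sum_congr rfl fun k _ => ?_
  rw [← map_sum]
  congr 1
  refine testFunction_ext fun z _ => ?_
  rw [testFunction_sum_apply, mulTest_apply, Matrix.mul_apply, Finset.sum_mul]
  refine Finset.sum_congr rfl fun j _ => ?_
  rw [mulTest_apply, mulTest_apply]
  ring

theorem mulVecDistr_of_eq_one (hM : SmoothMatrixOn Ω M) (h : ∀ z ∈ Ω, M z = 1)
    (v : Fin p → 𝓓'(Ω, ℝ)) : mulVecDistr M hM v = v := by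
  funext i
  ext f
  rw [mulVecDistr_apply, Finset.sum_eq_single i]
  · congr 1
    exact testFunction_ext fun z hz => by rw [mulTest_apply, h z hz, Matrix.one_apply_eq, one_mul]
  · intro j _ hj
    have : mulTest (fun z => M z i j) (hM i j) f = 0 :=
      testFunction_ext fun z hz => by
        rw [mulTest_apply, h z hz, Matrix.one_apply_ne hj.symm, zero_mul]
        rfl
    rw [this, map_zero]
  · simp

theorem mulVecDistr_neg (hM : SmoothMatrixOn Ω M) (v : Fin p → 𝓓'(Ω, ℝ)) :
    mulVecDistr (fun z => -M z) hM.neg v = -mulVecDistr M hM v := by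
  funext i
  ext f
  change mulVecDistr (fun z => -M z) hM.neg v i f = -(mulVecDistr M hM v i f)
  rw [mulVecDistr_apply, mulVecDistr_apply, ← Finset.sum_neg_distrib]
  refine Finset.sum_congr rfl fun j _ => ?_
  rw [← map_neg]
  congr 1
  exact testFunction_ext fun z _ => neg_mul _ _

theorem mulVecDistr_add (hM : SmoothMatrixOn Ω M) (v w : Fin p → 𝓓'(Ω, ℝ)) :
    mulVecDistr M hM (v + w) = mulVecDistr M hM v + mulVecDistr M hM w := by
  funext i
  ext f
  change mulVecDistr M hM (v + w) i f = mulVecDistr M hM v i f + mulVecDistr M hM w i f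
  rw [mulVecDistr_apply, mulVecDistr_apply, mulVecDistr_apply, ← Finset.sum_add_distrib]
  rfl

theorem mulVecDistr_zero (hM : SmoothMatrixOn Ω M) : mulVecDistr M hM 0 = 0 := by
  have := mulVecDistr_add hM 0 0
  rwa [add_zero, left_eq_add] at this

/-- The derivative in `x` of a vector distribution. -/
def derivX (v : Fin p → 𝓓'(Ω, ℝ)) : Fin p → 𝓓'(Ω, ℝ) := fun i => ∂_{((0, 1) : ℝ × ℝ)} (v i)

theorem derivX_add (v w : Fin p → 𝓓'(Ω, ℝ)) : derivX (v + w) = derivX v + derivX w :=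
  funext fun _ => LineDeriv.lineDerivOp_add _ _ _

/-- Bridges the classical equations, which only give derivatives along fibres, and the Fréchet
derivative in the product rule. -/
theorem fderiv_snd_eq {a b : ℝ × ℝ → ℝ} (ha : ContDiffOn ℝ ∞ a Ω)
    (h : ∀ t x : ℝ, (t, x) ∈ Ω → HasDerivAt (fun y => a (t, y)) (b (t, x)) x) {z : ℝ × ℝ}
    (hz : z ∈ Ω) : fderiv ℝ a z (0, 1) = b z := by
  have hda : HasFDerivAt a (fderiv ℝ a z) (z.1, z.2) :=
    ((ha.differentiableOn (by simp)).differentiableAt (Ω.isOpen.mem_nhds hz)).hasFDerivAt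
  exact (hda.comp_hasDerivAt z.2 ((hasDerivAt_const z.2 z.1).prodMk (hasDerivAt_id z.2))).unique
    (h z.1 z.2 hz)

theorem derivX_mulVecDistr (hM : SmoothMatrixOn Ω M) (hM' : SmoothMatrixOn Ω M')
    (h : ∀ t x : ℝ, (t, x) ∈ Ω → ∀ i j, HasDerivAt (fun y => M (t, y) i j) (M' (t, x) i j) x)
    (v : Fin p → 𝓓'(Ω, ℝ)) :
    derivX (mulVecDistr M hM v) = mulVecDistr M' hM' v + mulVecDistr M hM (derivX v) := by
  funext i
  change ∂_{((0, 1) : ℝ × ℝ)} (∑ j, smulDistr (fun z => M z i j) (hM i j) (v j)) =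
    (∑ j, smulDistr (fun z => M' z i j) (hM' i j) (v j)) +
      ∑ j, smulDistr (fun z => M z i j) (hM i j) (∂_{((0, 1) : ℝ × ℝ)} (v j))
  rw [LineDeriv.lineDerivOp_sum, ← Finset.sum_add_distrib]
  exact Finset.sum_congr rfl fun j _ => lineDeriv_smulDistr _ _
    (fun z hz => fderiv_snd_eq (b := fun z => M' z i j) (hM i j)
      (fun t x hx => h t x hx i j) hz) _

theorem isDistrSolution_iff {A : ℝ × ℝ → Matrix (Fin p) (Fin p) ℝ} {hA : SmoothMatrixOn Ω A}
    {F : ℝ × ℝ → Fin p → ℝ} {v : Fin p → 𝓓'(Ω, ℝ)} :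
    IsDistrSolution A hA F v ↔ derivX v = mulVecDistr A hA v + regularVecDistr Ω F :=
  funext_iff.symm

/-- A smooth classical solution is a solution in the sense of distributions. -/
theorem IsSolution.derivX_regularVecDistr {A : ℝ × ℝ → Matrix (Fin p) (Fin p) ℝ}
    (hA : SmoothMatrixOn Ω A) {F ψ : ℝ × ℝ → Fin p → ℝ} (hF : ContDiffOn ℝ ∞ F Ω)
    (hψ : ContDiffOn ℝ ∞ ψ Ω) (h : IsSolution Ω A F ψ) :
    derivX (regularVecDistr Ω ψ) =
      mulVecDistr A hA (regularVecDistr Ω ψ) + regularVecDistr Ω F := by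
  have hψ' := contDiffOn_pi.1 hψ
  have hF' := contDiffOn_pi.1 hF
  have hR := contDiffOn_pi.1 ((hA.contDiffOn_mulVec hψ).add hF)
  funext i
  have e : derivX (regularVecDistr Ω ψ) i = smulDistr _ (hR i) (regularDistr fun _ => 1) := by
    change ∂_{((0, 1) : ℝ × ℝ)} (regularDistr (fun z => ψ z i)) = _
    rw [regularDistr_eq_smulDistr (hψ' i), lineDeriv_smulDistr (hψ' i) (hR i)
      (fun z hz => fderiv_snd_eq (b := fun z => ((A z).mulVec (ψ z) + F z) i) (hψ' i)
        (fun t x hx => hasDerivAt_pi.1 (h.2 t x hx) i) hz), lineDeriv_regularDistr_one]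
    ext f
    change _ + smulDistr _ _ 0 f = _
    rw [smulDistr_apply]
    exact add_zero _
  rw [e]
  ext f
  change smulDistr _ _ _ f = mulVecDistr A hA (regularVecDistr Ω ψ) i f +
    (regularDistr (fun z => F z i) : 𝓓'(Ω, ℝ)) f
  rw [mulVecDistr_apply, regularDistr_eq_smulDistr (hF' i)]
  have e2 : ∀ j g, regularVecDistr Ω ψ j g =
      (regularDistr (fun _ => 1) : 𝓓'(Ω, ℝ)) (mulTest _ (hψ' j) g) := fun j g => by
    rw [regularVecDistr, regularDistr_eq_smulDistr (hψ' j), smulDistr_apply]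
  simp only [e2, smulDistr_apply]
  rw [← map_sum, ← map_add]
  congr 1
  refine testFunction_ext fun z _ => ?_
  change (∑ j, A z i j * ψ z j + F z i) * f z = (∑ j, _ : 𝓓(Ω, ℝ)) z + F z i * f z
  rw [testFunction_sum_apply, add_mul, Finset.sum_mul]
  congr 1
  refine Finset.sum_congr rfl fun j _ => ?_
  rw [mulTest_apply, mulTest_apply]
  ring

end MatrixProducts

end DistODE

end

noncomputable section

namespace DistODE

open Filter Topology MeasureTheory

/-! ### Fibre bumps and the map `φ ↦ φ χ` on test functions -/

section FibreMul

variable {X : Opens ℝ} {Ω : Opens (ℝ × ℝ)} {χ : ℝ × ℝ → ℝ}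

/-- `χ` is smooth over `X`, and its support over compact subsets of `X` is a compact subset
of `Ω`. -/
structure IsFibreBump (X : Opens ℝ) (Ω : Opens (ℝ × ℝ)) (χ : ℝ × ℝ → ℝ) : Prop where
  contDiffOn : ContDiffOn ℝ ∞ χ {z | z.1 ∈ X}
  exists_compact : ∀ K : Compacts ℝ, (K : Set ℝ) ⊆ X →
    ∃ L : Compacts (ℝ × ℝ), (L : Set (ℝ × ℝ)) ⊆ Ω ∧ ∀ z : ℝ × ℝ, z.1 ∈ K → z ∉ L → χ z = 0
  fst_mem : ∀ z ∈ Ω, z.1 ∈ X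

theorem isOpen_fst_mem (X : Opens ℝ) : IsOpen {z : ℝ × ℝ | z.1 ∈ X} :=
  X.isOpen.preimage continuous_fst

theorem IsFibreBump.contDiff_mul (hχ : IsFibreBump X Ω χ) {f : ℝ → ℝ} (hf : ContDiff ℝ ∞ f)
    (hs : tsupport f ⊆ X) : ContDiff ℝ ∞ fun z : ℝ × ℝ => f z.1 * χ z := by
  rw [contDiff_iff_contDiffAt]
  intro z
  by_cases hz : z.1 ∈ tsupport f
  · exact (hf.comp contDiff_fst).contDiffAt.mul
      (hχ.contDiffOn.contDiffAt ((isOpen_fst_mem X).mem_nhds (hs hz)))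
  · have h0 : (fun z : ℝ × ℝ => f z.1 * χ z) =ᶠ[𝓝 z] fun _ => 0 := by
      filter_upwards [((isClosed_tsupport f).isOpen_compl.preimage continuous_fst).mem_nhds hz]
        with y hy
      rw [image_eq_zero_of_notMem_tsupport hy, zero_mul]
    exact contDiffAt_const.congr_of_eventuallyEq h0

theorem norm_iteratedFDeriv_comp_fst_le {f : ℝ → ℝ} (hf : ContDiff ℝ ∞ f) (j : ℕ) (z : ℝ × ℝ) :
    ‖iteratedFDeriv ℝ j (fun z : ℝ × ℝ => f z.1) z‖ ≤ ‖iteratedFDeriv ℝ j f z.1‖ := by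
  have h := (ContinuousLinearMap.fst ℝ ℝ ℝ).iteratedFDeriv_comp_right hf z (i := j)
    (by exact_mod_cast le_top)
  change ‖iteratedFDeriv ℝ j (f ∘ ContinuousLinearMap.fst ℝ ℝ ℝ) z‖ ≤ _
  rw [h]
  refine (ContinuousMultilinearMap.norm_compContinuousLinearMap_le _ _).trans ?_
  refine mul_le_of_le_one_right (norm_nonneg _) ?_
  exact Finset.prod_le_one (fun _ _ => norm_nonneg _)
    fun _ _ => ContinuousLinearMap.norm_fst_le ℝ ℝ ℝ

/-- `f ↦ f(t) χ(t, x)` as a linear map, for `f` supported in `K`. -/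
def IsFibreBump.mulSupportedInLM (hχ : IsFibreBump X Ω χ) {K : Compacts ℝ}
    (hK : (K : Set ℝ) ⊆ X) {L : Compacts (ℝ × ℝ)}
    (hKL : ∀ z : ℝ × ℝ, z.1 ∈ K → z ∉ L → χ z = 0) :
    𝓓_{K}(ℝ, ℝ) →ₗ[ℝ] 𝓓_{L}(ℝ × ℝ, ℝ) where
  toFun f := ⟨fun z => f z.1 * χ z,
    hχ.contDiff_mul f.contDiff (f.tsupport_subset.trans hK), fun z hz => by
      by_cases h : z.1 ∈ K
      · exact (congrArg _ (hKL z h hz)).trans (mul_zero _)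
      · exact (congrArg (· * χ z) (f.zero_on_compl h)).trans (zero_mul _)⟩
  map_add' f g := ContDiffMapSupportedIn.ext fun z => add_mul (f z.1) (g z.1) (χ z)
  map_smul' c f := ContDiffMapSupportedIn.ext fun z => mul_assoc c (f z.1) (χ z)

/-- Leibniz estimate: the derivatives of `χ` are bounded on the compact set `L`, and those of `f(t)`
are bounded by seminorms of `f`. -/
theorem IsFibreBump.exists_bound (hχ : IsFibreBump X Ω χ) {K : Compacts ℝ}
    {L : Compacts (ℝ × ℝ)} (hL : (L : Set (ℝ × ℝ)) ⊆ Ω) (i : ℕ) :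
    ∃ (s : Finset ℕ) (C : ℝ), 0 ≤ C ∧ ∀ f : 𝓓_{K}(ℝ, ℝ), ∀ z ∈ L,
      ‖iteratedFDeriv ℝ i (fun z : ℝ × ℝ => f z.1 * χ z) z‖ ≤
        C * (s.sup fun j => ContDiffMapSupportedIn.seminorm ℝ ℝ ℝ ⊤ K j) f := by
  set U : Set (ℝ × ℝ) := {z | z.1 ∈ X}
  have hUo : IsOpen U := isOpen_fst_mem X
  have hLU : (L : Set (ℝ × ℝ)) ⊆ U := fun z hz => hχ.fst_mem z (hL hz)
  have hb : ∀ j : ℕ, ∃ C : ℝ, 0 ≤ C ∧ ∀ x ∈ L, ‖iteratedFDerivWithin ℝ j χ U x‖ ≤ C := by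
    intro j
    have hc : ContinuousOn (fun x => ‖iteratedFDerivWithin ℝ j χ U x‖) L :=
      ((hχ.contDiffOn.continuousOn_iteratedFDerivWithin (by exact_mod_cast le_top)
        hUo.uniqueDiffOn).mono hLU).norm
    obtain ⟨C, hC⟩ := L.isCompact.bddAbove_image hc
    exact ⟨max C 0, le_max_right _ _, fun x hx =>
      (hC (Set.mem_image_of_mem _ hx)).trans (le_max_left _ _)⟩
  choose C hC0 hC using hb
  refine ⟨Finset.range (i + 1), ∑ j ∈ Finset.range (i + 1), (i.choose j : ℝ) * C (i - j),
    Finset.sum_nonneg fun j _ => mul_nonneg (Nat.cast_nonneg _) (hC0 _), fun f z hz => ?_⟩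
  have hz' := hLU hz
  have hn : (i : ℕ∞ω) ≤ ∞ := by exact_mod_cast le_top
  have hf : ContDiffOn ℝ ∞ (fun z : ℝ × ℝ => f z.1) U :=
    (f.contDiff.comp contDiff_fst).contDiffOn
  have key := norm_iteratedFDerivWithin_mul_le hf hχ.contDiffOn hUo.uniqueDiffOn hz' hn
  rw [iteratedFDerivWithin_of_isOpen i hUo hz'] at key
  refine key.trans ?_
  rw [Finset.sum_mul]
  refine Finset.sum_le_sum fun j hj => ?_
  rw [iteratedFDerivWithin_of_isOpen j hUo hz', mul_assoc, mul_assoc]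
  refine mul_le_mul_of_nonneg_left ?_ (Nat.cast_nonneg _)
  rw [mul_comm]
  refine mul_le_mul (hC _ z hz) ?_ (norm_nonneg _) (hC0 _)
  refine (norm_iteratedFDeriv_comp_fst_le f.contDiff j z).trans ?_
  refine (ContDiffMapSupportedIn.norm_iteratedFDeriv_apply_le_seminorm_top ℝ).trans ?_
  exact Seminorm.le_finset_sup_apply (i := j)
    (p := fun j => ContDiffMapSupportedIn.seminorm ℝ ℝ ℝ ⊤ K j) hj

/-- `f ↦ f(t) χ(t, x)` as a continuous linear map, for `f` supported in `K`. -/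
def IsFibreBump.mulSupportedIn (hχ : IsFibreBump X Ω χ) {K : Compacts ℝ} (hK : (K : Set ℝ) ⊆ X)
    {L : Compacts (ℝ × ℝ)} (hL : (L : Set (ℝ × ℝ)) ⊆ Ω)
    (hKL : ∀ z : ℝ × ℝ, z.1 ∈ K → z ∉ L → χ z = 0) :
    𝓓_{K}(ℝ, ℝ) →L[ℝ] 𝓓_{L}(ℝ × ℝ, ℝ) :=
  { toLinearMap := hχ.mulSupportedInLM hK hKL
    cont := show Continuous (hχ.mulSupportedInLM hK hKL) by
      refine WithSeminorms.continuous_of_isBounded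
        (ContDiffMapSupportedIn.withSeminorms ℝ _ _ _ _)
        (ContDiffMapSupportedIn.withSeminorms ℝ _ _ _ _) _ (.of_real fun i => ?_)
      obtain ⟨s, C, hC, h⟩ := hχ.exists_bound (K := K) hL i
      refine ⟨s, C, fun f => ?_⟩
      exact (ContDiffMapSupportedIn.seminorm_top_le_iff ℝ
        (mul_nonneg hC (apply_nonneg _ _)) i (hχ.mulSupportedInLM hK hKL f)).2 fun z hz =>
          h f z hz }

/-- `f ↦ f(t) χ(t, x)` on test functions. -/
def IsFibreBump.mulTest (hχ : IsFibreBump X Ω χ) : 𝓓(X, ℝ) →L[ℝ] 𝓓(Ω, ℝ) :=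
  -- The compact set `L` is chosen separately for each `K`, but the underlying function does not
  -- involve it, so the compatibility conditions hold by `rfl`.
  letI T : ∀ K : Compacts ℝ, (K : Set ℝ) ⊆ X → 𝓓_{K}(ℝ, ℝ) →L[ℝ] 𝓓(Ω, ℝ) := fun K hK =>
    TestFunction.ofSupportedInCLM ℝ (hχ.exists_compact K hK).choose_spec.1 ∘L
      hχ.mulSupportedIn hK (hχ.exists_compact K hK).choose_spec.1
        (hχ.exists_compact K hK).choose_spec.2
  TestFunction.limitCLM ℝ
    (fun f => (T ⟨tsupport f, f.hasCompactSupport⟩ f.tsupport_subset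
      (.of_support_subset f.contDiff subset_closure)).copy (fun z => f z.1 * χ z) rfl)
    T (fun _ _ _ => TestFunction.ext fun _ => rfl)

theorem IsFibreBump.mulTest_apply (hχ : IsFibreBump X Ω χ) (f : 𝓓(X, ℝ)) (z : ℝ × ℝ) :
    hχ.mulTest f z = f z.1 * χ z := rfl

/-- An `x`-simple open set carries a fibre bump with integral one on every fibre. -/
theorem exists_isFibreBump (hΩ : IsXSimple (Ω : Set (ℝ × ℝ))) :
    ∃ χ : ℝ × ℝ → ℝ, IsFibreBump (prT Ω) Ω χ ∧ ∀ t ∈ prT Ω, ∫ x, χ (t, x) = 1 := by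
  obtain ⟨c, e, hc, he, hce⟩ := exists_smooth_section hΩ
  -- Outer radius `1` confines the rescaled bump to `|x - c t| ≤ e t`, which lies in `Ω`; the inner
  -- radius is arbitrary. Dividing by `e t` keeps the integral equal to one.
  let β : ContDiffBump (0 : ℝ) := ⟨1 / 2, 1, by norm_num, by norm_num⟩
  let ρ : ℝ → ℝ := β.normed volume
  refine ⟨fun z => ρ ((z.2 - c z.1) / e z.1) / e z.1, ⟨?_, ?_, fun z hz => mem_prT hz⟩, ?_⟩
  · have h1 : ContDiffOn ℝ ∞ (fun z : ℝ × ℝ => c z.1) {z | z.1 ∈ prT Ω} :=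
      hc.comp contDiff_fst.contDiffOn fun _ h => h
    have h2 : ContDiffOn ℝ ∞ (fun z : ℝ × ℝ => e z.1) {z | z.1 ∈ prT Ω} :=
      he.comp contDiff_fst.contDiffOn fun _ h => h
    have h0 : ∀ z ∈ {z : ℝ × ℝ | z.1 ∈ prT Ω}, e z.1 ≠ 0 := fun z hz => (hce _ hz).1.ne'
    exact (β.contDiff_normed.comp_contDiffOn
      ((contDiff_snd.contDiffOn.sub h1).div h2 h0)).div h2 h0
  · intro K hK
    let m : ℝ × ℝ → ℝ × ℝ := fun q => (q.1, c q.1 + q.2 * e q.1)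
    have hm : ContinuousOn m ((K : Set ℝ) ×ˢ Set.Icc (-1 : ℝ) 1) := by
      have hfst : Set.MapsTo Prod.fst ((K : Set ℝ) ×ˢ Set.Icc (-1 : ℝ) 1) (prT Ω : Set ℝ) :=
        fun q hq => hK hq.1
      exact continuousOn_fst.prodMk ((hc.continuousOn.comp continuousOn_fst hfst).add
        (continuousOn_snd.mul (he.continuousOn.comp continuousOn_fst hfst)))
    refine ⟨⟨_, (K.isCompact.prod isCompact_Icc).image_of_continuousOn hm⟩, ?_, ?_⟩
    · rintro _ ⟨⟨t, s⟩, ⟨ht, hs⟩, rfl⟩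
      have := hce t (hK ht)
      refine this.2 _ ?_
      change |c t + s * e t - c t| ≤ e t
      rw [add_sub_cancel_left, abs_mul, abs_of_pos this.1]
      exact mul_le_of_le_one_left this.1.le (abs_le.2 hs)
    · rintro ⟨t, x⟩ ht hz
      have he0 := (hce t (hK ht)).1
      have hout : (x - c t) / e t ∉ Function.support ρ := by
        intro h
        rw [β.support_normed_eq, Metric.mem_ball, dist_zero_right, Real.norm_eq_abs] at h
        refine hz ⟨(t, (x - c t) / e t), ⟨ht, abs_le.1 h.le⟩, ?_⟩
        simp only [m, div_mul_cancel₀ _ he0.ne', add_sub_cancel]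
      rw [Function.notMem_support] at hout
      simp only [hout, zero_div]
  · intro t ht
    have he0 := (hce t ht).1
    simp only
    rw [integral_div, integral_sub_right_eq_self (fun x => ρ (x / e t)) (c t),
      Measure.integral_comp_div, abs_of_pos he0, β.integral_normed, smul_eq_mul, mul_one,
      div_self he0.ne']

end FibreMul

end DistODE

end

noncomputable section

namespace DistODE

open Filter Topology MeasureTheory

/-! ### Primitives of test functions along the fibres -/

section Slices

variable {Ω : Opens (ℝ × ℝ)}

theorem integrable_slice (f : 𝓓(Ω, ℝ)) (t : ℝ) : Integrable fun x => f (t, x) := by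
  have hc : Continuous fun x => f (t, x) := f.continuous.comp (by fun_prop)
  refine hc.integrable_of_hasCompactSupport
    (HasCompactSupport.intro (f.hasCompactSupport.isCompact.image continuous_snd) fun x hx => ?_)
  exact image_eq_zero_of_notMem_tsupport (f := f) (x := (t, x)) fun h => hx ⟨(t, x), h, rfl⟩

theorem hasDerivAt_slice (f : 𝓓(Ω, ℝ)) (t x : ℝ) :
    HasDerivAt (fun x => f (t, x)) ((∂_{((0, 1) : ℝ × ℝ)} f) (t, x)) x := by
  rw [lineDeriv_test_apply]
  exact (f.contDiff.differentiable (by simp) (t, x)).hasFDerivAt.comp_hasDerivAt x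
    ((hasDerivAt_const x t).prodMk (hasDerivAt_id x))

theorem integral_slice_lineDeriv (f : 𝓓(Ω, ℝ)) (t : ℝ) :
    ∫ x, (∂_{((0, 1) : ℝ × ℝ)} f) (t, x) = 0 :=
  integral_eq_zero_of_hasDerivAt_of_integrable (hasDerivAt_slice f t) (integrable_slice _ t)
    (integrable_slice f t)

/-- The union of the segments in the direction of `x` with end points in `K`. -/
def xHull (K : Set (ℝ × ℝ)) : Set (ℝ × ℝ) :=
  {z | ∃ y₁ y₂, (z.1, y₁) ∈ K ∧ (z.1, y₂) ∈ K ∧ y₁ ≤ z.2 ∧ z.2 ≤ y₂}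

/-- The hull is the continuous image of a compact set: pairs of points of `K` on a common fibre,
together with a ratio in the unit interval. -/
theorem isCompact_xHull {K : Set (ℝ × ℝ)} (hK : IsCompact K) : IsCompact (xHull K) := by
  let D : Set (((ℝ × ℝ) × (ℝ × ℝ)) × ℝ) :=
    ((K ×ˢ K) ×ˢ Set.Icc (0 : ℝ) 1) ∩ {q | q.1.1.1 = q.1.2.1}
  have hD : IsCompact D := ((hK.prod hK).prod isCompact_Icc).inter_right
    (isClosed_eq (by fun_prop) (by fun_prop))
  let m : ((ℝ × ℝ) × (ℝ × ℝ)) × ℝ → ℝ × ℝ :=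
    fun q => (q.1.1.1, q.1.1.2 + q.2 * (q.1.2.2 - q.1.1.2))
  have : xHull K = m '' D := by
    ext ⟨t, x⟩
    constructor
    · rintro ⟨y₁, y₂, h1, h2, h3, h4⟩
      rcases (h3.trans h4).eq_or_lt with h | h
      · refine ⟨(((t, y₁), (t, y₂)), 0), ⟨⟨⟨h1, h2⟩, le_rfl, zero_le_one⟩, rfl⟩, ?_⟩
        have : y₁ = x := le_antisymm h3 (h4.trans h.symm.le)
        simp [m, this]
      · have h5 : 0 < y₂ - y₁ := sub_pos.2 h
        refine ⟨(((t, y₁), (t, y₂)), (x - y₁) / (y₂ - y₁)), ⟨⟨⟨h1, h2⟩,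
          div_nonneg (sub_nonneg.2 h3) h5.le, (div_le_one h5).2 (by linarith)⟩, rfl⟩, ?_⟩
        simp only [m, div_mul_cancel₀ _ h5.ne', add_sub_cancel]
    · rintro ⟨⟨⟨⟨a, y₁⟩, ⟨b, y₂⟩⟩, s⟩, ⟨⟨⟨h1, h2⟩, hs0, hs1⟩, hab⟩, heq⟩
      simp only [m, Prod.mk.injEq] at heq
      change a = b at hab
      obtain ⟨rfl, rfl⟩ := heq
      subst hab
      simp only at h1 h2 hs0 hs1
      rcases le_total y₁ y₂ with h | h
      · exact ⟨y₁, y₂, h1, h2, by nlinarith, by nlinarith⟩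
      · exact ⟨y₂, y₁, h2, h1, by nlinarith, by nlinarith⟩
  rw [this]
  exact hD.image (by fun_prop)

theorem xHull_subset (hΩ : IsXSimple (Ω : Set (ℝ × ℝ))) {K : Set (ℝ × ℝ)}
    (hK : K ⊆ Ω) : xHull K ⊆ Ω := by
  rintro ⟨t, x⟩ ⟨y₁, y₂, h1, h2, h3, h4⟩
  exact hΩ.mem_of_mem_Icc (hK h1) (hK h2) h3 h4

/-- Lets the results on primitives be applied on the whole plane, with base curve `x = -R`, to a
test function extended by zero. -/
theorem isXSimple_univ : IsXSimple ((⊤ : Opens (ℝ × ℝ)) : Set (ℝ × ℝ)) := fun t =>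
  ⟨⊥, ⊤, by ext x; simp [EReal.bot_lt_coe, EReal.coe_lt_top]⟩

/-- A test function with vanishing integrals over the fibres is an `x`-derivative. -/
theorem exists_lineDeriv_eq (hΩ : IsXSimple (Ω : Set (ℝ × ℝ))) (h : 𝓓(Ω, ℝ))
    (hint : ∀ t, ∫ x, h (t, x) = 0) : ∃ g : 𝓓(Ω, ℝ), ∂_{((0, 1) : ℝ × ℝ)} g = h := by
  obtain ⟨R, hR⟩ := h.hasCompactSupport.isCompact.isBounded.subset_ball (0 : ℝ × ℝ)
  have hlt : ∀ t y, h (t, y) ≠ 0 → -R < y := by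
    intro t y hy
    have := hR (subset_tsupport _ hy)
    rw [Metric.mem_ball, dist_zero_right] at this
    exact (abs_lt.1 ((norm_snd_le ((t, y) : ℝ × ℝ)).trans_lt this)).1
  -- Starting to the left of the support, `G` vanishes before the support on each fibre, and beyond
  -- it because the full integral is zero. So `G` is supported in `xHull (tsupport h)`, which lies
  -- in `Ω` by `x`-simplicity.
  let G : ℝ × ℝ → ℝ := fun z => ∫ y in -R..z.2, h (z.1, y)
  have hG : ContDiff ℝ ∞ G := contDiffOn_univ.1
    (contDiffOn_primitive (Ω := ⊤) (c := fun _ => -R) isXSimple_univ contDiffOn_const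
      (fun _ _ => trivial) h.contDiff.contDiffOn)
  have hGd : ∀ t x, HasDerivAt (fun y => G (t, y)) (h (t, x)) x := fun t x =>
    hasDerivAt_primitive (Ω := ⊤) isXSimple_univ h.continuous.continuousOn trivial trivial
  have hG0 : ∀ z, z ∉ xHull (tsupport h) → G z = 0 := by
    rintro ⟨t, x⟩ hz
    by_cases hex : ∃ y, h (t, y) ≠ 0 ∧ y ≤ x
    · obtain ⟨y, hy, hyx⟩ := hex
      have hsupp : Function.support (fun y => h (t, y)) ⊆ Set.Ioc (-R) x := fun w hw =>
        ⟨hlt t w hw, le_of_not_gt fun hxw => hz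
          ⟨y, w, subset_tsupport _ hy, subset_tsupport _ hw, hyx, hxw.le⟩⟩
      exact (intervalIntegral.integral_eq_integral_of_support_subset hsupp).trans (hint t)
    -- Here `x` may lie to the left of `-R`, so both orientations of the interval occur.
    · refine intervalIntegral.integral_zero_ae (.of_forall fun y hy => ?_)
      by_contra hne
      have hxy : x < y := lt_of_not_ge fun hyx => hex ⟨y, hne, hyx⟩
      rcases Set.mem_uIoc.1 hy with h1 | h1
      · exact absurd h1.2 (not_le.2 hxy)
      · exact absurd (hlt t y hne) (not_lt.2 h1.2)
  have hcomp := isCompact_xHull h.hasCompactSupport.isCompact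
  have hts : tsupport G ⊆ xHull (tsupport h) :=
    closure_minimal (fun z hz => by_contra fun hn => hz (hG0 z hn)) hcomp.isClosed
  refine ⟨⟨G, hG, hcomp.of_isClosed_subset (isClosed_tsupport G) hts,
    hts.trans (xHull_subset hΩ h.tsupport_subset)⟩, testFunction_ext fun z hz => ?_⟩
  rw [lineDeriv_test_apply]
  exact fderiv_snd_eq (Ω := Ω) hG.contDiffOn (fun t x _ => hGd t x) hz

end Slices

/-! ### Distributions constant in `x`, and the general solution -/

section Invariant

variable {p : ℕ} {Ω : Opens (ℝ × ℝ)}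

/-- Pairing with `T_1` in `x` is integration over the fibres; `φ` is the resulting test function of
`t`. -/
theorem tensorOne_apply (ζ : Fin p → 𝓓'(prT Ω, ℝ)) (i : Fin p) (f : 𝓓(Ω, ℝ)) :
    ∃ φ : 𝓓(prT Ω, ℝ), tensorOne Ω ζ i f = ζ i φ ∧ ∀ t, φ t = ∫ x, f (t, x) := by
  refine ⟨_, (restrictDistr_apply _ _ _).trans (tensorDistr_apply _ _ _), fun t => ?_⟩
  rw [partialPair_apply, Set.indicator_univ, regularDistr_one_apply]
  rfl

theorem derivX_tensorOne (ζ : Fin p → 𝓓'(prT Ω, ℝ)) : derivX (tensorOne Ω ζ) = 0 := by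
  funext i
  ext f
  change ∂_{((0, 1) : ℝ × ℝ)} (tensorOne Ω ζ i) f = 0
  rw [Distribution.lineDerivOp_apply_apply, map_neg]
  obtain ⟨φ, h1, h2⟩ := tensorOne_apply ζ i (∂_{((0, 1) : ℝ × ℝ)} f)
  have : φ = 0 := TestFunction.ext fun t => (h2 t).trans (integral_slice_lineDeriv f t)
  rw [h1, this, map_zero, neg_zero]

/-- A distribution with vanishing `x`-derivative on an `x`-simple set is constant in `x`. -/
theorem exists_eq_tensorOne (hΩ : IsXSimple (Ω : Set (ℝ × ℝ))) {u : Fin p → 𝓓'(Ω, ℝ)}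
    (hu : derivX u = 0) : ∃ ζ : Fin p → 𝓓'(prT Ω, ℝ), u = tensorOne Ω ζ := by
  obtain ⟨χ, hχ, hχ1⟩ := exists_isFibreBump hΩ
  -- The coefficient is forced: if `u = ζ ⊗ 1`, testing on `φ χ` returns `ζ(φ)`, because `χ` has
  -- fibre integrals one.
  refine ⟨fun i => hχ.mulTest.precompCompactConvergenceCLM ℝ (u i), ?_⟩
  funext i
  ext f
  obtain ⟨φ, h1, h2⟩ :=
    tensorOne_apply (fun i => hχ.mulTest.precompCompactConvergenceCLM ℝ (u i)) i f
  rw [h1]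
  change u i f = u i (hχ.mulTest φ)
  obtain ⟨g, hg⟩ := exists_lineDeriv_eq hΩ (f - hχ.mulTest φ) fun t => by
    have e : ∀ x, (f - hχ.mulTest φ) (t, x) = f (t, x) - hχ.mulTest φ (t, x) := fun _ => rfl
    simp only [e]
    rw [integral_sub (integrable_slice f t) (integrable_slice _ t), ← h2, sub_eq_zero]
    simp only [hχ.mulTest_apply]
    rw [integral_const_mul]
    -- The bump is normalised only over `prT Ω`; elsewhere `φ` vanishes.
    by_cases ht : t ∈ prT Ω
    · rw [hχ1 t ht, mul_one]
    · rw [testFunction_eq_zero φ ht, zero_mul]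
  have h3 : ∂_{((0, 1) : ℝ × ℝ)} (u i) g = 0 := by
    change derivX u i g = 0
    rw [hu]
    rfl
  rw [Distribution.lineDerivOp_apply_apply, hg, map_neg, map_sub, neg_eq_zero] at h3
  exact sub_eq_zero.1 h3

theorem isDistrSolution_iff_exists_tensorOne (hΩ : IsXSimple (Ω : Set (ℝ × ℝ)))
    {A Φ : ℝ × ℝ → Matrix (Fin p) (Fin p) ℝ} (hA : SmoothMatrixOn Ω A)
    {F ψ : ℝ × ℝ → Fin p → ℝ} (hF : ContDiffOn ℝ ∞ F Ω) (hψ : ContDiffOn ℝ ∞ ψ Ω)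
    (hψs : IsSolution Ω A F ψ) (hΦ : SmoothMatrixOn Ω Φ) (hΦf : IsFundamentalMatrix Ω A Φ)
    (v : Fin p → 𝓓'(Ω, ℝ)) : IsDistrSolution A hA F v ↔
      ∃ ζ : Fin p → 𝓓'(prT Ω, ℝ),
        v = regularVecDistr Ω ψ + mulVecDistr Φ hΦ (tensorOne Ω ζ) := by
  have hTψ := hψs.derivX_regularVecDistr hA hF hψ
  rw [isDistrSolution_iff]
  constructor
  · intro hv
    obtain ⟨w, rfl⟩ : ∃ w, v = regularVecDistr Ω ψ + w := ⟨_, (add_sub_cancel _ v).symm⟩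
    have hw : derivX w = mulVecDistr A hA w := by
      rw [derivX_add, hTψ, mulVecDistr_add, add_assoc, add_assoc,
        add_comm (mulVecDistr A hA w)] at hv
      exact add_left_cancel (add_left_cancel hv)
    obtain ⟨N, hN, hNf, hΦN⟩ := hΦf.exists_inverse hΩ hA hΦ
    -- `(N w)_x = -N A w + N A w`.
    have hu : derivX (mulVecDistr N hN w) = 0 := by
      rw [derivX_mulVecDistr hN (hN.mul hA).neg hNf, hw, mulVecDistr_neg (hN.mul hA),
        mulVecDistr_mulVecDistr, neg_add_cancel]
    obtain ⟨ζ, hζ⟩ := exists_eq_tensorOne hΩ hu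
    refine ⟨ζ, ?_⟩
    rw [← hζ, mulVecDistr_mulVecDistr, mulVecDistr_of_eq_one _ hΦN]
  · rintro ⟨ζ, rfl⟩
    rw [derivX_add, hTψ, derivX_mulVecDistr hΦ (hA.mul hΦ) hΦf.hasDerivAt, derivX_tensorOne,
      mulVecDistr_zero, add_zero, mulVecDistr_add, mulVecDistr_mulVecDistr]
    abel

end Invariant

end DistODE

end

theorem mainTheorem11 (Ω : Opens (ℝ × ℝ)) (hΩ : DistODE.IsXSimple (Ω : Set (ℝ × ℝ))) (p : ℕ)
    (A : ℝ × ℝ → Matrix (Fin p) (Fin p) ℝ) (hA : DistODE.SmoothMatrixOn Ω A)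
    (F : ℝ × ℝ → Fin p → ℝ) (hF : ContDiffOn ℝ ∞ F Ω) :
    (∃ ψ : ℝ × ℝ → Fin p → ℝ, ContDiffOn ℝ ∞ ψ Ω ∧ DistODE.IsSolution Ω A F ψ) ∧
    (∃ Φ : ℝ × ℝ → Matrix (Fin p) (Fin p) ℝ,
      DistODE.SmoothMatrixOn Ω Φ ∧ DistODE.IsFundamentalMatrix Ω A Φ) ∧
    ∀ ψ : ℝ × ℝ → Fin p → ℝ, ContDiffOn ℝ ∞ ψ Ω → DistODE.IsSolution Ω A F ψ →
    ∀ (Φ : ℝ × ℝ → Matrix (Fin p) (Fin p) ℝ) (hΦ : DistODE.SmoothMatrixOn Ω Φ),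
      DistODE.IsFundamentalMatrix Ω A Φ →
    ∀ v : Fin p → 𝓓'(Ω, ℝ), DistODE.IsDistrSolution A hA F v ↔
      ∃ ζ : Fin p → 𝓓'(DistODE.prT Ω, ℝ),
        v = DistODE.regularVecDistr Ω ψ + DistODE.mulVecDistr Φ hΦ (DistODE.tensorOne Ω ζ) := by
  refine ⟨DistODE.exists_smooth_solution hΩ hA hF, ?_, fun ψ hψ hψs Φ hΦ hΦf v =>
    DistODE.isDistrSolution_iff_exists_tensorOne hΩ hA hF hψ hψs hΦ hΦf v⟩
  obtain ⟨Φ, Ψ, hΦs, hΨs, hΦ, hΨ, h1, h2⟩ := DistODE.exists_flows hΩ hA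
  exact ⟨Φ, hΦs, DistODE.isFundamentalMatrix_of_flows hΩ hA hΦs hΨs hΦ hΨ h1 h2⟩
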